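/- Let $(X_1,Y_1),\dots,(X_n,Y_n)$ be i.i.d. with joint distribution function $H$ on $\mathbb R^2$ whose margins $F,G$ are continuous, and let $C$ be the copula of $H$, i.e. the joint distribution function of $(F(X_1),G(Y_1))$. Let $R_i$ and $S_i$ be the ranks of $X_i$ and $Y_i$ among $X_1,\dots,X_n$ and $Y_1,\dots,Y_n$, let $C_n(u,v)=\frac1n\#\{i: R_i/n\le u,\ S_i/n\le v\}$ be the empirical copula, let $\bar C_n$ be the bilinear interpolation of $C_n$ from the points $(i/n,j/n)$, $0\le i,j\le n$, and put $$\bar q_n(u,v)=\frac{\bar C_n(u,v)-uv}{\sqrt{uv(1-u)(1-v)}},\qquad (u,v)\in(0,1)^2 .$$ For integers $s(n)\ge 0$ let $d(n)=2^{s(n)+1}-1$ and $K(n)=d(n)^2$; for $t(n)\in(0,1)$ let $\kappa(n)=\lceil t(n)K(n)\rceil$. Let $|\bar Q|_{(1)}\le\dots\le|\bar Q|_{(K(n))}$ be the ordered values of $|\sqrt n\,\bar q_n(u,v)|$ over the grid of points $(u,v)=\big(j/(d(n)+1),\,j'/(d(n)+1)\big)$, $1\le j,j'\le d(n)$, and let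 $$T_n=\frac{1}{K(n)-\kappa(n)+1}\sum_{k=\kappa(n)}^{K(n)}|\bar Q|_{(k)} .$$ For $\alpha\in(0,1)$ let $c_n(\alpha)$ be the infimum of all $c\in\mathbb R$ such that $P(T_n>c)\le\alpha$ under every $H$ with continuous margins that satisfies the independence hypothesis $\mathbb H_0: H(x,y)=F(x)G(y)$ for all $(x,y)\in\mathbb R^2$. Theorem. Suppose that $t(n)\in(0,1)$ for all $n$, that $d(n)\to\infty$ and that $d(n)/\sqrt n\to0$ as $n\to\infty$. Then, for every $\alpha\in(0,1)$, the test that rejects $\mathbb H_0$ when $T_n>c_n(\alpha)$ has level $\alpha$, i.e. $P_H(T_n>c_n(\alpha))\le\alpha$ for every $n$ and every $H$ with continuous margins that satisfies $\mathbb H_0$, and it is consistent: for every fixed $H$ with continuous margins that does not satisfy $\mathbb H_0$ and whose copula $C$ is such that $\partial C/\partial u$ exists and is continuous on $(0,1)\times[0,1]$ and $\partial C/\partial v$ exists and is continuous on $[0,1]\times(0,1)$, $$P_H\big(T_n>c_n(\alpha)\big)\longrightarrow 1\qquad (n\to\infty).$$ -/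

import Mathlib

open MeasureTheory ProbabilityTheory Set Filter Topology

noncomputable section

namespace RankTest

/-! ### The population model -/

/-- The marginal distribution functions `F` and `G` of the law `μ` of `(X, Y)` are continuous. -/
def ContinuousMargins (μ : Measure (ℝ × ℝ)) : Prop :=
  Continuous (cdf μ.fst) ∧ Continuous (cdf μ.snd)

/-- The joint distribution function `H(x, y) = P(X ≤ x, Y ≤ y)`. -/
def jointCdf (μ : Measure (ℝ × ℝ)) (x y : ℝ) : ℝ :=
  μ.real (Iic x ×ˢ Iic y)

/-- The independence hypothesis: `H(x, y) = F(x) G(y)` for all `x`, `y`. -/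
def Independence (μ : Measure (ℝ × ℝ)) : Prop :=
  ∀ x y : ℝ, jointCdf μ x y = cdf μ.fst x * cdf μ.snd y

/-- The copula of a law with continuous margins: the joint distribution function of
`(F(X), G(Y))`. -/
def copula (μ : Measure (ℝ × ℝ)) (u v : ℝ) : ℝ :=
  μ.real {p | cdf μ.fst p.1 ≤ u ∧ cdf μ.snd p.2 ≤ v}

/-- `∂C/∂u` exists and is continuous on `(0,1) × [0,1]`, and `∂C/∂v` exists and is continuous on
`[0,1] × (0,1)`. -/
structure ContinuousPartials (C : ℝ → ℝ → ℝ) : Prop where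
  exists_fst : ∀ u ∈ Ioo (0 : ℝ) 1, ∀ v ∈ Icc (0 : ℝ) 1, DifferentiableAt ℝ (fun x => C x v) u
  continuous_fst : ContinuousOn (fun p : ℝ × ℝ => deriv (fun x => C x p.2) p.1)
    (Ioo (0 : ℝ) 1 ×ˢ Icc (0 : ℝ) 1)
  exists_snd : ∀ u ∈ Icc (0 : ℝ) 1, ∀ v ∈ Ioo (0 : ℝ) 1, DifferentiableAt ℝ (fun y => C u y) v
  continuous_snd : ContinuousOn (fun p : ℝ × ℝ => deriv (fun y => C p.1 y) p.2)
    (Icc (0 : ℝ) 1 ×ˢ Ioo (0 : ℝ) 1)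

/-- The law of an i.i.d. sample of size `n` from `μ`. -/
def sampleLaw (μ : Measure (ℝ × ℝ)) (n : ℕ) : Measure (Fin n → ℝ × ℝ) :=
  Measure.pi fun _ => μ

/-! ### The test statistic -/

/-- The rank of `x i` in the sample `x`. -/
def rank {n : ℕ} (x : Fin n → ℝ) (i : Fin n) : ℕ :=
  (Finset.univ.filter fun k => x k ≤ x i).card

/-- The empirical copula `C_n`. -/
def empCopula {n : ℕ} (z : Fin n → ℝ × ℝ) (u v : ℝ) : ℝ :=
  ((Finset.univ.filter fun i : Fin n =>
      (rank (fun k => (z k).1) i : ℝ) / n ≤ u ∧ (rank (fun k => (z k).2) i : ℝ) / n ≤ v).card : ℝ) / n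

/-- The bilinear interpolation of `C_n` between the points of the grid `(i/n, j/n)`. -/
def bilinearCopula {n : ℕ} (z : Fin n → ℝ × ℝ) (u v : ℝ) : ℝ :=
  (1 - n * u + ⌊n * u⌋₊) * (1 - n * v + ⌊n * v⌋₊)
      * empCopula z ((⌊n * u⌋₊ : ℝ) / n) ((⌊n * v⌋₊ : ℝ) / n)
    + (n * u - ⌊n * u⌋₊) * (1 - n * v + ⌊n * v⌋₊)
      * empCopula z (((⌊n * u⌋₊ : ℝ) + 1) / n) ((⌊n * v⌋₊ : ℝ) / n)
    + (1 - n * u + ⌊n * u⌋₊) * (n * v - ⌊n * v⌋₊)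
      * empCopula z ((⌊n * u⌋₊ : ℝ) / n) (((⌊n * v⌋₊ : ℝ) + 1) / n)
    + (n * u - ⌊n * u⌋₊) * (n * v - ⌊n * v⌋₊)
      * empCopula z (((⌊n * u⌋₊ : ℝ) + 1) / n) (((⌊n * v⌋₊ : ℝ) + 1) / n)

/-- The estimator of the quantile dependence function. -/
def qBar {n : ℕ} (z : Fin n → ℝ × ℝ) (u v : ℝ) : ℝ :=
  (bilinearCopula z u v - u * v) / √(u * v * (1 - u) * (1 - v))

/-- The number `2^(s+1) - 1` of dyadic points of level `s` in `(0,1)`. -/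
def gridSize (s : ℕ) : ℕ := 2 ^ (s + 1) - 1

/-- The dyadic point `(i+1) / 2^(s+1)`, for `i = 0, …, gridSize s - 1`. -/
def gridPoint (s : ℕ) (i : Fin (gridSize s)) : ℝ := ((i : ℝ) + 1) / 2 ^ (s + 1)

/-- The number of points of the two-dimensional grid of level `s`. -/
def gridCard (s : ℕ) : ℕ := gridSize s * gridSize s

/-- The values `|√n q̄_n|` on the grid of level `s`, listed in some order. -/
def gridValues (s : ℕ) {n : ℕ} (z : Fin n → ℝ × ℝ) (k : Fin (gridCard s)) : ℝ :=
  |√(n : ℝ) *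
    qBar z (gridPoint s (finProdFinEquiv.symm k).1) (gridPoint s (finProdFinEquiv.symm k).2)|

/-- The order statistics of `f`: its values in nondecreasing order, indexed from `0`. -/
def orderStat {K : ℕ} (f : Fin K → ℝ) (k : Fin K) : ℝ := f (Tuple.sort f k)

/-- The average of the order statistics of `f` whose position, counted from `1`, is one of
`κ, κ + 1, …, K`. -/
def upperAverage {K : ℕ} (κ : ℕ) (f : Fin K → ℝ) : ℝ :=
  (∑ k : Fin K, if κ ≤ (k : ℕ) + 1 then orderStat f k else 0) / ((K : ℝ) - κ + 1)

/-- The statistic `T_n`, for the grid of level `s` and the trimming parameter `t`. -/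
def testStat (s : ℕ) (t : ℝ) {n : ℕ} (z : Fin n → ℝ × ℝ) : ℝ :=
  upperAverage ⌈t * gridCard s⌉₊ (gridValues s z)

/-- The critical value at level `α` of the test that rejects for large values of `T_n`: the
smallest `c` with `P(T_n > c) ≤ α` under every law that has continuous margins and satisfies the
independence hypothesis. -/
def criticalValue (s : ℕ) (t : ℝ) (n : ℕ) (α : ℝ) : ℝ :=
  sInf {c : ℝ | ∀ ν : Measure (ℝ × ℝ), IsProbabilityMeasure ν → ContinuousMargins ν →
    Independence ν → (sampleLaw ν n).real {z | c < testStat s t z} ≤ α}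

/-- The samples for which the level `α` test rejects independence. -/
def rejectionRegion (s : ℕ) (t : ℝ) (n : ℕ) (α : ℝ) : Set (Fin n → ℝ × ℝ) :=
  {z | criticalValue s t n α < testStat s t z}

end RankTest

end

/-!
The statistic `T_n` lies between the mean and the maximum of the values `|√n q̄_n|` on the grid
(`mean_le_testStat`, `testStat_le`), and these two bounds are all that is used of it.

*Level.* The thresholds `c` with `P(T_n > c) ≤ α` under all laws of the hypothesis form an upper
set, which is nonempty since `T_n` is bounded and bounded below since `T_n ≥ 0`. Its infimum belongs
to it because `c ↦ P(T_n > c)` is right continuous (`measureReal_rejectionRegion_le`).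

*The critical value is `o(√n)`.* Under independence the rank vectors of the two coordinates are
independent and exchangeable, so that at a node `(p, q) = (a/n, b/n)` the empirical copula has the
hypergeometric variance `p(1-p) q(1-q) / (n-1)` (`integral_empCopula_sub_sq`). The error
`C̄_n(u, v) - uv` is the bilinear interpolation of the errors at the nodes; convexity of the square
and concavity of `p(1-p)` give `E (C̄_n(u, v) - uv)² ≤ u(1-u) v(1-v) / (n-1)` for all `(u, v)`
(`integral_bilinearCopula_sub_sq_le`), which is `E q̄_n² ≤ 1/(n-1)`. Chebyshev's inequality and a
union bound over the `d(n)²` points of the grid give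
`P(T_n > ε √n) ≤ d(n)² / ((n-1) ε²)`, uniformly over the hypothesis
(`measureReal_lt_testStat_le`). As `d(n)/√n → 0`, eventually `c_n(α) ≤ ε √n` for each `ε > 0`.

*The statistic grows like `√n` under dependence.* If `H(x₀, y₀) ≠ F(x₀) G(y₀)`, put
`u₀ = F(x₀)` and `v₀ = G(y₀)`. The observations with normalised rank at most `u₀` and those with
`X ≤ x₀` are both initial segments of the ordered sample, so their difference is controlled by the
numbers of their elements; hence `C_n(u₀, v₀) → H(x₀, y₀)` in probability follows from Chebyshev's
inequality for three relative frequencies (`measureReal_lt_abs_empCopula_sub_le`). As `C_n` is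
monotone, the deviation at `(u₀, v₀)` persists on a square with corner near that point
(`exists_square`), which contains a fixed proportion of the grid. So the mean of `|√n q̄_n|` over the
grid is at least `ρ √n` with probability tending to one, for some `ρ > 0`, and exceeds the critical
value.
-/

namespace RankTest

/-! ### Averages of the largest order statistics -/

theorem sum_orderStat {K : ℕ} (f : Fin K → ℝ) : ∑ k, orderStat f k = ∑ k, f k :=
  Equiv.sum_comp (Tuple.sort f) f

theorem monotone_orderStat {K : ℕ} (f : Fin K → ℝ) : Monotone (orderStat f) :=
  Tuple.monotone_sort f

theorem sum_upper_indicator {K κ : ℕ} (h1 : 1 ≤ κ) (hK : κ ≤ K) :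
    ∑ k : Fin K, (if κ ≤ (k : ℕ) + 1 then (1 : ℝ) else 0) = (K : ℝ) - κ + 1 := by
  rw [Fin.sum_univ_eq_sum_range (fun k : ℕ => if κ ≤ k + 1 then (1 : ℝ) else 0) K,
    Finset.sum_boole]
  have : (Finset.range K).filter (fun k => κ ≤ k + 1) = Finset.Ico (κ - 1) K := by
    ext k
    simp only [Finset.mem_filter, Finset.mem_range, Finset.mem_Ico]
    omega
  rw [this, Nat.card_Ico, Nat.cast_sub (by omega), Nat.cast_sub h1]
  push_cast
  ring

theorem upperAverage_le {K κ : ℕ} (h1 : 1 ≤ κ) (hK : κ ≤ K) {f : Fin K → ℝ} {c : ℝ}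
    (hf : ∀ k, f k ≤ c) : upperAverage κ f ≤ c := by
  have hpos : (0 : ℝ) < (K : ℝ) - κ + 1 := by
    have : (κ : ℝ) ≤ K := by exact_mod_cast hK
    linarith
  rw [upperAverage, div_le_iff₀ hpos, ← sum_upper_indicator h1 hK, Finset.mul_sum]
  refine Finset.sum_le_sum fun k _ => ?_
  split_ifs
  · rw [mul_one]
    exact hf _
  · simp

/-- The mean of the largest values is at least the mean of all values: Chebyshev's sum inequality
for the order statistics and the indicator of the upper positions. -/
theorem mean_le_upperAverage {K κ : ℕ} (h1 : 1 ≤ κ) (hK : κ ≤ K) (f : Fin K → ℝ) :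
    (∑ k, f k) / K ≤ upperAverage κ f := by
  have hpos : (0 : ℝ) < (K : ℝ) - κ + 1 := by
    have : (κ : ℝ) ≤ K := by exact_mod_cast hK
    linarith
  have hKpos : (0 : ℝ) < K := by exact_mod_cast (by omega : 0 < K)
  have hmono : Monovary (fun k : Fin K => if κ ≤ (k : ℕ) + 1 then (1 : ℝ) else 0)
      (orderStat f) := by
    refine Monotone.monovary (fun i j hij => ?_) (monotone_orderStat f)
    have : (i : ℕ) ≤ j := hij
    split_ifs with h h'
    · exact le_rfl
    · omega
    · exact zero_le_one
    · exact le_rfl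
  have h := hmono.sum_mul_sum_le_card_mul_sum
  rw [sum_upper_indicator h1 hK, sum_orderStat, Fintype.card_fin] at h
  rw [upperAverage, div_le_div_iff₀ hKpos hpos]
  simp only [ite_mul, one_mul, zero_mul] at h
  linarith

/-! ### The grid -/

theorem gridCard_pos (s : ℕ) : 0 < gridCard s := by
  have : 1 < 2 ^ (s + 1) := Nat.one_lt_two_pow (by omega)
  unfold gridCard gridSize
  exact Nat.mul_pos (by omega) (by omega)

theorem one_le_ceil_trim {t : ℝ} (ht : t ∈ Ioo (0 : ℝ) 1) (s : ℕ) : 1 ≤ ⌈t * gridCard s⌉₊ := by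
  have : (0 : ℝ) < gridCard s := by exact_mod_cast gridCard_pos s
  exact Nat.one_le_ceil_iff.2 (mul_pos ht.1 this)

theorem ceil_trim_le {t : ℝ} (ht : t ∈ Ioo (0 : ℝ) 1) (s : ℕ) :
    ⌈t * gridCard s⌉₊ ≤ gridCard s := by
  refine Nat.ceil_le.2 ?_
  have : (0 : ℝ) ≤ gridCard s := Nat.cast_nonneg _
  nlinarith [ht.2]

theorem gridSize_cast (s : ℕ) : (gridSize s : ℝ) = 2 ^ (s + 1) - 1 := by
  have : 1 ≤ 2 ^ (s + 1) := Nat.one_le_two_pow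
  rw [gridSize, Nat.cast_sub this]
  norm_num

theorem gridPoint_mem (s : ℕ) (i : Fin (gridSize s)) : gridPoint s i ∈ Ioo (0 : ℝ) 1 := by
  have h : (0 : ℝ) < 2 ^ (s + 1) := by positivity
  refine ⟨by unfold gridPoint; positivity, ?_⟩
  rw [gridPoint, div_lt_one h]
  have h1 : (i : ℝ) + 1 ≤ gridSize s := by exact_mod_cast i.2
  rw [gridSize_cast] at h1
  linarith

theorem testStat_le {s n : ℕ} {t c : ℝ} (ht : t ∈ Ioo (0 : ℝ) 1) {z : Fin n → ℝ × ℝ}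
    (h : ∀ k, gridValues s z k ≤ c) : testStat s t z ≤ c :=
  upperAverage_le (one_le_ceil_trim ht s) (ceil_trim_le ht s) h

theorem mean_le_testStat {s n : ℕ} {t : ℝ} (ht : t ∈ Ioo (0 : ℝ) 1) (z : Fin n → ℝ × ℝ) :
    (∑ i, ∑ j, |√(n : ℝ) * qBar z (gridPoint s i) (gridPoint s j)|) / gridCard s
      ≤ testStat s t z := by
  refine le_of_eq_of_le ?_ (mean_le_upperAverage (one_le_ceil_trim ht s) (ceil_trim_le ht s) _)
  congr 1
  rw [← Fintype.sum_prod_type',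
    ← Equiv.sum_comp (finProdFinEquiv (m := gridSize s) (n := gridSize s)).symm]
  rfl

theorem testStat_nonneg {s n : ℕ} {t : ℝ} (ht : t ∈ Ioo (0 : ℝ) 1) (z : Fin n → ℝ × ℝ) :
    0 ≤ testStat s t z :=
  le_trans (by positivity) (mean_le_testStat ht z)

/-- An interval `[a, b]` contains at least `2^(s+1) (b - a) - 1` dyadic points of level `s`. -/
theorem card_gridPoint_mem {a b : ℝ} (ha : 0 < a) (hb : b < 1) (s : ℕ) :
    (b - a) * 2 ^ (s + 1) - 1 ≤
      ((Finset.univ.filter fun i => gridPoint s i ∈ Icc a b).card : ℝ) := by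
  have hm : (0 : ℝ) < 2 ^ (s + 1) := by positivity
  have h : (Finset.Icc ⌈a * 2 ^ (s + 1)⌉₊ ⌊b * 2 ^ (s + 1)⌋₊) ⊆
      (Finset.univ.filter fun i => gridPoint s i ∈ Icc a b).image
        (fun i : Fin (gridSize s) => (i : ℕ) + 1) := by
    intro j hj
    rw [Finset.mem_Icc] at hj
    obtain ⟨h1, h2⟩ := hj
    have hj1 : 1 ≤ j := le_trans (Nat.one_le_ceil_iff.2 (by positivity)) h1
    have h1' : a * 2 ^ (s + 1) ≤ j := Nat.ceil_le.1 h1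
    have h2' : (j : ℝ) ≤ b * 2 ^ (s + 1) := (Nat.le_floor_iff' (by omega)).1 h2
    have hj2 : j < 2 ^ (s + 1) := by
      have : (j : ℝ) < 2 ^ (s + 1) := by nlinarith
      exact_mod_cast this
    have hc : ((j - 1 : ℕ) : ℝ) + 1 = j := by
      rw [Nat.cast_sub hj1]; simp
    simp only [Finset.mem_image, Finset.mem_filter, Finset.mem_univ, true_and]
    refine ⟨⟨j - 1, by unfold gridSize; omega⟩, ⟨?_, ?_⟩, by simp; omega⟩
    · simp only [gridPoint, hc]
      rwa [le_div_iff₀ hm]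
    · simp only [gridPoint, hc]
      rwa [div_le_iff₀ hm]
  have h' := (Finset.card_le_card h).trans Finset.card_image_le
  rw [Nat.card_Icc] at h'
  have h1 := Nat.ceil_lt_add_one (a := a * 2 ^ (s + 1)) (by positivity)
  have h2 := Nat.lt_floor_add_one (b * (2 : ℝ) ^ (s + 1))
  have h3 : ((⌊b * (2 : ℝ) ^ (s + 1)⌋₊ : ℕ) : ℝ) + 1 ≤
      ((Finset.univ.filter fun i => gridPoint s i ∈ Icc a b).card : ℝ) +
        ⌈a * (2 : ℝ) ^ (s + 1)⌉₊ := by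
    norm_cast at h' ⊢
    omega
  linarith

/-! ### Bilinear interpolation -/

theorem empCopula_nonneg {n : ℕ} (z : Fin n → ℝ × ℝ) (u v : ℝ) : 0 ≤ empCopula z u v := by
  unfold empCopula; positivity

theorem empCopula_mono {n : ℕ} (z : Fin n → ℝ × ℝ) {u u' v v' : ℝ} (hu : u ≤ u') (hv : v ≤ v') :
    empCopula z u v ≤ empCopula z u' v' := by
  unfold empCopula
  refine div_le_div_of_nonneg_right ?_ (Nat.cast_nonneg _)
  exact_mod_cast Finset.card_le_card
    (Finset.monotone_filter_right _ fun i _ => And.imp hu.trans' hv.trans')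

theorem empCopula_le_one {n : ℕ} (z : Fin n → ℝ × ℝ) (u v : ℝ) : empCopula z u v ≤ 1 := by
  refine div_le_one_of_le₀ ?_ (Nat.cast_nonneg _)
  exact_mod_cast (Finset.card_filter_le _ _).trans (by simp)

theorem fract_weight_mem (n : ℕ) {u : ℝ} (hu : 0 ≤ u) :
    (n : ℝ) * u - ⌊(n : ℝ) * u⌋₊ ∈ Icc (0 : ℝ) 1 := by
  have h1 := Nat.floor_le (a := (n : ℝ) * u) (by positivity)
  have h2 := Nat.lt_floor_add_one ((n : ℝ) * u)
  exact ⟨by linarith, by linarith⟩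

theorem bilinear_le {θ τ a b c d m : ℝ} (hθ : θ ∈ Icc (0 : ℝ) 1) (hτ : τ ∈ Icc (0 : ℝ) 1)
    (ha : a ≤ m) (hb : b ≤ m) (hc : c ≤ m) (hd : d ≤ m) :
    (1 - θ) * (1 - τ) * a + θ * (1 - τ) * b + (1 - θ) * τ * c + θ * τ * d ≤ m := by
  have h1 := sub_nonneg.2 hθ.2
  have h2 := sub_nonneg.2 hτ.2
  have e1 := mul_le_mul_of_nonneg_left ha (mul_nonneg h1 h2)
  have e2 := mul_le_mul_of_nonneg_left hb (mul_nonneg hθ.1 h2)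
  have e3 := mul_le_mul_of_nonneg_left hc (mul_nonneg h1 hτ.1)
  have e4 := mul_le_mul_of_nonneg_left hd (mul_nonneg hθ.1 hτ.1)
  linarith

theorem bilinear_sq_le {θ τ a b c d : ℝ} (hθ : θ ∈ Icc (0 : ℝ) 1) (hτ : τ ∈ Icc (0 : ℝ) 1) :
    ((1 - θ) * (1 - τ) * a + θ * (1 - τ) * b + (1 - θ) * τ * c + θ * τ * d) ^ 2 ≤
      (1 - θ) * (1 - τ) * a ^ 2 + θ * (1 - τ) * b ^ 2 + (1 - θ) * τ * c ^ 2 + θ * τ * d ^ 2 := by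
  have h1 := sub_nonneg.2 hθ.2
  have h2 := sub_nonneg.2 hτ.2
  set m := (1 - θ) * (1 - τ) * a + θ * (1 - τ) * b + (1 - θ) * τ * c + θ * τ * d with hm
  -- the difference of the two sides is the weighted variance of the corner values
  have e1 := mul_nonneg (mul_nonneg h1 h2) (sq_nonneg (a - m))
  have e2 := mul_nonneg (mul_nonneg hθ.1 h2) (sq_nonneg (b - m))
  have e3 := mul_nonneg (mul_nonneg h1 hτ.1) (sq_nonneg (c - m))
  have e4 := mul_nonneg (mul_nonneg hθ.1 hτ.1) (sq_nonneg (d - m))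
  have e : (1 - θ) * (1 - τ) * a ^ 2 + θ * (1 - τ) * b ^ 2 + (1 - θ) * τ * c ^ 2
      + θ * τ * d ^ 2 - m ^ 2 = (1 - θ) * (1 - τ) * (a - m) ^ 2 + θ * (1 - τ) * (b - m) ^ 2
      + (1 - θ) * τ * (c - m) ^ 2 + θ * τ * (d - m) ^ 2
      + 2 * m * ((1 - θ) * (1 - τ) * a + θ * (1 - τ) * b + (1 - θ) * τ * c + θ * τ * d - m) := by
    ring
  rw [← hm, sub_self, mul_zero] at e
  linarith

theorem bilinearCopula_eq {n : ℕ} (z : Fin n → ℝ × ℝ) (u v : ℝ) :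
    bilinearCopula z u v =
      (1 - (n * u - ⌊n * u⌋₊)) * (1 - (n * v - ⌊n * v⌋₊))
        * empCopula z ((⌊n * u⌋₊ : ℝ) / n) ((⌊n * v⌋₊ : ℝ) / n)
      + (n * u - ⌊n * u⌋₊) * (1 - (n * v - ⌊n * v⌋₊))
        * empCopula z (((⌊n * u⌋₊ : ℝ) + 1) / n) ((⌊n * v⌋₊ : ℝ) / n)
      + (1 - (n * u - ⌊n * u⌋₊)) * (n * v - ⌊n * v⌋₊)
        * empCopula z ((⌊n * u⌋₊ : ℝ) / n) (((⌊n * v⌋₊ : ℝ) + 1) / n)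
      + (n * u - ⌊n * u⌋₊) * (n * v - ⌊n * v⌋₊)
        * empCopula z (((⌊n * u⌋₊ : ℝ) + 1) / n) (((⌊n * v⌋₊ : ℝ) + 1) / n) := by
  unfold bilinearCopula; ring

theorem bilinearCopula_le {n : ℕ} (z : Fin n → ℝ × ℝ) {u v : ℝ} (hu : 0 ≤ u) (hv : 0 ≤ v) :
    bilinearCopula z u v ≤
      empCopula z (((⌊n * u⌋₊ : ℝ) + 1) / n) (((⌊n * v⌋₊ : ℝ) + 1) / n) := by
  have h : ∀ a : ℝ, a / n ≤ (a + 1) / n := fun a => by gcongr; linarith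
  rw [bilinearCopula_eq]
  exact bilinear_le (fract_weight_mem n hu) (fract_weight_mem n hv) (empCopula_mono z (h _) (h _))
    (empCopula_mono z le_rfl (h _)) (empCopula_mono z (h _) le_rfl) le_rfl

theorem le_bilinearCopula {n : ℕ} (z : Fin n → ℝ × ℝ) {u v : ℝ} (hu : 0 ≤ u) (hv : 0 ≤ v) :
    empCopula z ((⌊n * u⌋₊ : ℝ) / n) ((⌊n * v⌋₊ : ℝ) / n) ≤ bilinearCopula z u v := by
  have h : ∀ a : ℝ, a / n ≤ (a + 1) / n := fun a => by gcongr; linarith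
  have := bilinear_le (fract_weight_mem n hu) (fract_weight_mem n hv)
    (neg_le_neg (le_refl (empCopula z ((⌊n * u⌋₊ : ℝ) / n) ((⌊n * v⌋₊ : ℝ) / n))))
    (neg_le_neg (empCopula_mono z (h _) le_rfl)) (neg_le_neg (empCopula_mono z le_rfl (h _)))
    (neg_le_neg (empCopula_mono z (h _) (h _)))
  rw [bilinearCopula_eq]
  linarith

theorem sqrt_weight_pos {u v : ℝ} (hu : u ∈ Ioo (0 : ℝ) 1) (hv : v ∈ Ioo (0 : ℝ) 1) :
    0 < √(u * v * (1 - u) * (1 - v)) := by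
  have h1 := sub_pos.2 hu.2
  have h2 := sub_pos.2 hv.2
  have := hu.1
  have := hv.1
  positivity

theorem sqrt_weight_le_one {u v : ℝ} (hu : u ∈ Ioo (0 : ℝ) 1) (hv : v ∈ Ioo (0 : ℝ) 1) :
    √(u * v * (1 - u) * (1 - v)) ≤ 1 := by
  refine Real.sqrt_le_one.2 ?_
  have h1 := mul_le_one₀ hu.2.le hv.1.le hv.2.le
  have h2 := mul_le_one₀ h1 (sub_nonneg.2 hu.2.le) (by linarith [hu.1] : 1 - u ≤ 1)
  exact mul_le_one₀ h2 (sub_nonneg.2 hv.2.le) (by linarith [hv.1] : 1 - v ≤ 1)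

theorem abs_sub_le_abs_qBar {n : ℕ} (z : Fin n → ℝ × ℝ) {u v : ℝ} (hu : u ∈ Ioo (0 : ℝ) 1)
    (hv : v ∈ Ioo (0 : ℝ) 1) : |bilinearCopula z u v - u * v| ≤ |qBar z u v| := by
  rw [qBar, abs_div, abs_of_pos (sqrt_weight_pos hu hv), le_div_iff₀ (sqrt_weight_pos hu hv)]
  exact mul_le_of_le_one_right (abs_nonneg _) (sqrt_weight_le_one hu hv)

theorem abs_bilinearCopula_sub_le {n : ℕ} (z : Fin n → ℝ × ℝ) {u v : ℝ} (hu : u ∈ Ioo (0 : ℝ) 1)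
    (hv : v ∈ Ioo (0 : ℝ) 1) : |bilinearCopula z u v - u * v| ≤ 1 := by
  have h1 := (bilinearCopula_le z hu.1.le hv.1.le).trans (empCopula_le_one z _ _)
  have h2 := (empCopula_nonneg z _ _).trans (le_bilinearCopula z hu.1.le hv.1.le)
  have h3 := mul_le_one₀ hu.2.le hv.1.le hv.2.le
  have h4 := mul_pos hu.1 hv.1
  rw [abs_le]
  constructor <;> linarith

/-- The statistic is bounded, uniformly in the sample. -/
theorem exists_testStat_le (s n : ℕ) {t : ℝ} (ht : t ∈ Ioo (0 : ℝ) 1) :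
    ∃ B, ∀ z : Fin n → ℝ × ℝ, testStat s t z ≤ B := by
  have key : ∀ k : Fin (gridCard s), ∃ B, ∀ z : Fin n → ℝ × ℝ, gridValues s z k ≤ B := by
    intro k
    have hu := gridPoint_mem s (finProdFinEquiv.symm k).1
    have hv := gridPoint_mem s (finProdFinEquiv.symm k).2
    refine ⟨√(n : ℝ) * (1 / √(gridPoint s (finProdFinEquiv.symm k).1 *
      gridPoint s (finProdFinEquiv.symm k).2 * (1 - gridPoint s (finProdFinEquiv.symm k).1) *
      (1 - gridPoint s (finProdFinEquiv.symm k).2))), fun z => ?_⟩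
    rw [gridValues, abs_mul, abs_of_nonneg (Real.sqrt_nonneg _), qBar, abs_div,
      abs_of_pos (sqrt_weight_pos hu hv)]
    gcongr
    exact abs_bilinearCopula_sub_le z hu hv
  choose B hB using key
  obtain ⟨M, hM⟩ := Finite.exists_le B
  exact ⟨M, fun z => testStat_le ht fun k => (hB k z).trans (hM k)⟩

/-! ### Ranks of a sample without ties -/

theorem measurable_rank {n : ℕ} (i : Fin n) : Measurable fun x : Fin n → ℝ => rank x i := by
  simp only [rank, Finset.card_filter]
  refine Finset.measurable_sum _ fun k _ => ?_
  exact Measurable.ite (measurableSet_le (measurable_pi_apply k) (measurable_pi_apply i))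
    measurable_const measurable_const

theorem one_le_rank {n : ℕ} (x : Fin n → ℝ) (i : Fin n) : 1 ≤ rank x i :=
  Finset.card_pos.2 ⟨i, by simp⟩

theorem rank_le {n : ℕ} (x : Fin n → ℝ) (i : Fin n) : rank x i ≤ n :=
  (Finset.card_filter_le _ _).trans (by simp)

theorem rank_mono {n : ℕ} (x : Fin n → ℝ) {i j : Fin n} (h : x i ≤ x j) : rank x i ≤ rank x j :=
  Finset.card_le_card (Finset.monotone_filter_right _ fun _ _ => h.trans')

theorem rank_lt_rank {n : ℕ} (x : Fin n → ℝ) {i j : Fin n} (h : x i < x j) :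
    rank x i < rank x j := by
  refine Finset.card_lt_card ((Finset.ssubset_iff_of_subset
    (Finset.monotone_filter_right _ fun _ _ => h.le.trans')).2 ⟨j, by simp, by simpa using h⟩)

theorem rank_comp {n : ℕ} (x : Fin n → ℝ) (σ : Equiv.Perm (Fin n)) (i : Fin n) :
    rank (fun k => x (σ k)) i = rank x (σ i) := by
  simp only [rank, Finset.card_filter]
  exact Equiv.sum_comp σ fun k => if x k ≤ x (σ i) then 1 else 0

theorem rank_injective {n : ℕ} {x : Fin n → ℝ} (hx : Function.Injective x) :
    Function.Injective (rank x) := by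
  intro i j hij
  by_contra hne
  rcases lt_or_gt_of_ne (fun h => hne (hx h) : x i ≠ x j) with h | h
  · exact (rank_lt_rank x h).ne hij
  · exact (rank_lt_rank x h).ne' hij

theorem card_rank_le {n : ℕ} {x : Fin n → ℝ} (hx : Function.Injective x) {a : ℕ} (ha : a ≤ n) :
    (Finset.univ.filter fun i => rank x i ≤ a).card = a := by
  have himg : Finset.univ.image (rank x) = Finset.Icc 1 n := by
    refine Finset.eq_of_subset_of_card_le ?_ ?_
    · intro r hr
      obtain ⟨i, -, rfl⟩ := Finset.mem_image.1 hr
      exact Finset.mem_Icc.2 ⟨one_le_rank x i, rank_le x i⟩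
    · rw [Finset.card_image_of_injective _ (rank_injective hx)]
      simp
  have h : (Finset.univ.filter fun i => rank x i ≤ a).image (rank x) = Finset.Icc 1 a := by
    ext r
    have : r ∈ Finset.univ.image (rank x) ↔ r ∈ Finset.Icc 1 n := by rw [himg]
    simp only [Finset.mem_image, Finset.mem_univ, true_and, Finset.mem_Icc,
      Finset.mem_filter] at this ⊢
    constructor
    · rintro ⟨i, hi, rfl⟩
      exact ⟨one_le_rank x i, hi⟩
    · rintro ⟨h1, h2⟩
      obtain ⟨i, rfl⟩ := this.2 ⟨h1, h2.trans ha⟩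
      exact ⟨i, h2, rfl⟩
  rw [← Finset.card_image_of_injective _ (rank_injective hx), h]
  simp

/-- Independent draws from a law `m` without atoms are almost surely pairwise distinct, since the
diagonal is null for `m × m`. -/
theorem ae_injective (m : Measure ℝ) [IsProbabilityMeasure m] [NullSingletonClass m] (n : ℕ) :
    ∀ᵐ x ∂(Measure.pi fun _ : Fin n => m), Function.Injective x := by
  have key : ∀ i j : Fin n, i ≠ j → ∀ᵐ x ∂(Measure.pi fun _ : Fin n => m), x i ≠ x j := by
    intro i j hij
    have hind : IndepFun (fun x : Fin n → ℝ => x i) (fun x => x j)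
        (Measure.pi fun _ : Fin n => m) :=
      (iIndepFun_pi (μ := fun _ : Fin n => m) (X := fun _ x => x)
        fun _ => aemeasurable_id).indepFun hij
    rw [indepFun_iff_map_prod_eq_prod_map_map (measurable_pi_apply i).aemeasurable
      (measurable_pi_apply j).aemeasurable, (measurePreserving_eval (fun _ => m) i).map_eq,
      (measurePreserving_eval (fun _ => m) j).map_eq] at hind
    have hdiag : ∀ᵐ p ∂(m.prod m), p.1 ≠ p.2 := by
      rw [ae_iff, Measure.measure_prod_null (by
        simpa using measurableSet_eq_fun measurable_fst measurable_snd)]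
      refine Eventually.of_forall fun x => ?_
      simp
    rw [← hind] at hdiag
    exact ae_of_ae_map
      ((measurable_pi_apply i).prodMk (measurable_pi_apply j)).aemeasurable hdiag
  have hall : ∀ᵐ x ∂(Measure.pi fun _ : Fin n => m), ∀ i j : Fin n, i ≠ j → x i ≠ x j := by
    simp only [ae_all_iff]
    exact key
  filter_upwards [hall] with x hx i j hij
  by_contra hne
  exact hx i j hne hij

theorem integral_comp_perm (m : Measure ℝ) [IsProbabilityMeasure m] {n : ℕ}
    (σ : Equiv.Perm (Fin n)) (f : (Fin n → ℝ) → ℝ) :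
    ∫ x, f (fun k => x (σ k)) ∂(Measure.pi fun _ : Fin n => m)
      = ∫ x, f x ∂(Measure.pi fun _ : Fin n => m) := by
  have h := measurePreserving_piCongrLeft (fun _ : Fin n => m) σ.symm
  rw [← h.integral_comp (MeasurableEquiv.measurableEmbedding _) f]
  congr 1
  ext x
  congr 1
  ext k
  simp [MeasurableEquiv.coe_piCongrLeft, Equiv.piCongrLeft_apply]

/-! ### Moments of the centred rank indicators -/

/-- The indicator that `x i` is among the `a` smallest observations, centred at its mean `a / n`. -/
noncomputable def centredRank {n : ℕ} (a : ℕ) (i : Fin n) (x : Fin n → ℝ) : ℝ :=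
  (if rank x i ≤ a then 1 else 0) - (a : ℝ) / n

theorem measurable_centredRank {n : ℕ} (a : ℕ) (i : Fin n) :
    Measurable (centredRank a i) :=
  (Measurable.ite (measurableSet_le (measurable_rank i) measurable_const) measurable_const
    measurable_const).sub_const _

theorem abs_centredRank_le {n a : ℕ} (ha : a ≤ n) (i : Fin n) (x : Fin n → ℝ) :
    |centredRank a i x| ≤ 1 := by
  have h0 : (0 : ℝ) ≤ (a : ℝ) / n := by positivity
  have h1 : (a : ℝ) / n ≤ 1 := div_le_one_of_le₀ (by exact_mod_cast ha) (Nat.cast_nonneg _)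
  unfold centredRank
  rw [abs_le]
  split_ifs <;> constructor <;> linarith

theorem integrable_centredRank_mul {n a : ℕ} (ha : a ≤ n) (i j : Fin n)
    (P : Measure (Fin n → ℝ)) [IsProbabilityMeasure P] :
    Integrable (fun x => centredRank a i x * centredRank a j x) P := by
  refine Integrable.of_bound
    ((measurable_centredRank a i).mul (measurable_centredRank a j)).aestronglyMeasurable 1
    (Eventually.of_forall fun x => ?_)
  rw [Real.norm_eq_abs, abs_mul]
  exact mul_le_one₀ (abs_centredRank_le ha i x) (abs_nonneg _) (abs_centredRank_le ha j x)

theorem sum_rank_indicator {n a : ℕ} (ha : a ≤ n) {x : Fin n → ℝ} (hx : Function.Injective x) :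
    ∑ i, (if rank x i ≤ a then (1 : ℝ) else 0) = a := by
  rw [Finset.sum_boole, card_rank_le hx ha]

theorem sum_centredRank {n a : ℕ} (hn : 0 < n) (ha : a ≤ n) {x : Fin n → ℝ}
    (hx : Function.Injective x) : ∑ i, centredRank a i x = 0 := by
  have : (n : ℝ) ≠ 0 := by positivity
  simp only [centredRank, Finset.sum_sub_distrib, sum_rank_indicator ha hx, Finset.sum_const,
    Finset.card_univ, Fintype.card_fin, nsmul_eq_mul]
  field_simp
  ring

theorem sum_centredRank_sq {n a : ℕ} (hn : 0 < n) (ha : a ≤ n) {x : Fin n → ℝ}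
    (hx : Function.Injective x) :
    ∑ i, centredRank a i x * centredRank a i x = n * ((a : ℝ) / n * (1 - (a : ℝ) / n)) := by
  have hn' : (n : ℝ) ≠ 0 := by positivity
  have h : ∀ i, centredRank a i x * centredRank a i x =
      (1 - 2 * ((a : ℝ) / n)) * (if rank x i ≤ a then 1 else 0) + ((a : ℝ) / n) ^ 2 := by
    intro i
    unfold centredRank
    split_ifs <;> ring
  simp only [h, Finset.sum_add_distrib, ← Finset.mul_sum, sum_rank_indicator ha hx,
    Finset.sum_const, Finset.card_univ, Fintype.card_fin, nsmul_eq_mul]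
  field_simp
  ring

theorem centredRank_comp {n : ℕ} (a : ℕ) (i : Fin n) (σ : Equiv.Perm (Fin n)) (x : Fin n → ℝ) :
    centredRank a i (fun k => x (σ k)) = centredRank a (σ i) x := by
  simp only [centredRank, rank_comp]

theorem integral_centredRank_sq (m : Measure ℝ) [IsProbabilityMeasure m] [NullSingletonClass m]
    {n a : ℕ} (ha : a ≤ n) (i : Fin n) :
    ∫ x, centredRank a i x * centredRank a i x ∂(Measure.pi fun _ : Fin n => m)
      = (a : ℝ) / n * (1 - (a : ℝ) / n) := by
  have hn : 0 < n := i.pos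
  have hsame : ∀ j : Fin n,
      ∫ x, centredRank a j x * centredRank a j x ∂(Measure.pi fun _ : Fin n => m)
        = ∫ x, centredRank a i x * centredRank a i x ∂(Measure.pi fun _ : Fin n => m) := by
    intro j
    rw [← integral_comp_perm m (Equiv.swap i j) fun x => centredRank a i x * centredRank a i x]
    simp only [centredRank_comp, Equiv.swap_apply_left]
  have hsum : ∑ j : Fin n,
      ∫ x, centredRank a j x * centredRank a j x ∂(Measure.pi fun _ : Fin n => m)
        = n * ((a : ℝ) / n * (1 - (a : ℝ) / n)) := by
    rw [← integral_finsetSum _ fun j _ => integrable_centredRank_mul ha j j _]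
    rw [integral_congr_ae (g := fun _ => (n : ℝ) * ((a : ℝ) / n * (1 - (a : ℝ) / n)))]
    · simp
    · filter_upwards [ae_injective m n] with x hx using sum_centredRank_sq hn ha hx
  simp only [hsame, Finset.sum_const, Finset.card_univ, Fintype.card_fin, nsmul_eq_mul] at hsum
  exact mul_left_cancel₀ (by positivity) hsum

/-- The centred rank indicators sum to zero, so by exchangeability each of the `n - 1` covariances
with a fixed one is `-1/(n-1)` times the variance. -/
theorem integral_centredRank_mul (m : Measure ℝ) [IsProbabilityMeasure m] [NullSingletonClass m]
    {n a : ℕ} (ha : a ≤ n) {i j : Fin n} (hij : i ≠ j) :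
    ∫ x, centredRank a i x * centredRank a j x ∂(Measure.pi fun _ : Fin n => m)
      = -((a : ℝ) / n * (1 - (a : ℝ) / n)) / (n - 1) := by
  have hn : 0 < n := i.pos
  have hn1 : 1 < n := by
    by_contra h
    exact hij (Fin.ext (by omega))
  have hn1' : (1 : ℝ) < n := by exact_mod_cast hn1
  have hsame : ∀ k ∈ Finset.univ.erase i,
      ∫ x, centredRank a i x * centredRank a k x ∂(Measure.pi fun _ : Fin n => m)
        = ∫ x, centredRank a i x * centredRank a j x ∂(Measure.pi fun _ : Fin n => m) := by
    intro k hk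
    have hki : k ≠ i := Finset.ne_of_mem_erase hk
    rw [← integral_comp_perm m (Equiv.swap j k) fun x => centredRank a i x * centredRank a j x]
    simp only [centredRank_comp, Equiv.swap_apply_left,
      Equiv.swap_apply_of_ne_of_ne hij hki.symm]
  have hsum : ∑ k : Fin n,
      ∫ x, centredRank a i x * centredRank a k x ∂(Measure.pi fun _ : Fin n => m) = 0 := by
    rw [← integral_finsetSum _ fun k _ => integrable_centredRank_mul ha i k _]
    rw [integral_congr_ae (g := fun _ => (0 : ℝ))]
    · simp
    · filter_upwards [ae_injective m n] with x hx
      rw [← Finset.mul_sum, sum_centredRank hn ha hx, mul_zero]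
  rw [← Finset.add_sum_erase _ _ (Finset.mem_univ i), integral_centredRank_sq m ha,
    Finset.sum_congr rfl hsame, Finset.sum_const, Finset.card_erase_of_mem (Finset.mem_univ i),
    Finset.card_univ, Fintype.card_fin, nsmul_eq_mul, Nat.cast_sub hn] at hsum
  rw [eq_div_iff (by linarith)]
  push_cast at hsum
  linarith

/-! ### The empirical copula under independence -/

theorem nullSingletonClass_of_continuous_cdf (m : Measure ℝ) [IsProbabilityMeasure m]
    (h : Continuous (cdf m)) : NullSingletonClass m := by
  refine ⟨fun x => ?_⟩
  rw [← measure_cdf m, StieltjesFunction.measure_singleton,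
    h.continuousAt.continuousWithinAt.leftLim_eq]
  simp

theorem eq_prod_of_independence (ν : Measure (ℝ × ℝ)) [IsProbabilityMeasure ν]
    (h : Independence ν) : ν = ν.fst.prod ν.snd := by
  have hind : IndepFun (Prod.fst : ℝ × ℝ → ℝ) Prod.snd ν := by
    have hgen : ∀ f : ℝ × ℝ → ℝ, MeasurableSpace.comap f inferInstance =
        MeasurableSpace.generateFrom (preimage f '' range Iic) := fun f => by
      rw [BorelSpace.measurable_eq (α := ℝ), borel_eq_generateFrom_Iic ℝ,
        MeasurableSpace.comap_generateFrom]
    rw [IndepFun_iff_Indep, hgen, hgen]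
    refine IndepSets.indep' ?_ ?_ (isPiSystem_Iic.comap _) (isPiSystem_Iic.comap _) ?_
    · rintro _ ⟨_, ⟨x, rfl⟩, rfl⟩
      exact measurable_fst measurableSet_Iic
    · rintro _ ⟨_, ⟨x, rfl⟩, rfl⟩
      exact measurable_snd measurableSet_Iic
    · rw [IndepSets_iff]
      rintro _ _ ⟨_, ⟨x, rfl⟩, rfl⟩ ⟨_, ⟨y, rfl⟩, rfl⟩
      have hxy := h x y
      rw [jointCdf, cdf_eq_real, cdf_eq_real, Measure.real, Measure.real, Measure.real,
        ← ENNReal.toReal_mul, ENNReal.toReal_eq_toReal_iff' (measure_ne_top _ _)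
          (ENNReal.mul_ne_top (measure_ne_top _ _) (measure_ne_top _ _)),
        Measure.fst_apply measurableSet_Iic, Measure.snd_apply measurableSet_Iic] at hxy
      exact hxy
  rw [indepFun_iff_map_prod_eq_prod_map_map measurable_fst.aemeasurable
    measurable_snd.aemeasurable] at hind
  simpa [Measure.fst, Measure.snd] using hind

theorem empCopula_sub_eq {n a b : ℕ} (hn : 0 < n) (ha : a ≤ n) (hb : b ≤ n) {z : Fin n → ℝ × ℝ}
    (hx : Function.Injective fun k => (z k).1) (hy : Function.Injective fun k => (z k).2) :
    empCopula z ((a : ℝ) / n) ((b : ℝ) / n) - (a : ℝ) / n * ((b : ℝ) / n) =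
      (∑ i, centredRank a i (fun k => (z k).1) * centredRank b i (fun k => (z k).2)) / n := by
  have hn' : (0 : ℝ) < n := by positivity
  have h : ∀ i, centredRank a i (fun k => (z k).1) * centredRank b i (fun k => (z k).2) =
      (if rank (fun k => (z k).1) i ≤ a ∧ rank (fun k => (z k).2) i ≤ b then 1 else 0)
        - (b : ℝ) / n * (if rank (fun k => (z k).1) i ≤ a then 1 else 0)
        - (a : ℝ) / n * (if rank (fun k => (z k).2) i ≤ b then 1 else 0)
        + (a : ℝ) / n * ((b : ℝ) / n) := by
    intro i
    unfold centredRank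
    split_ifs <;> first | ring1 | (exfalso; tauto)
  simp only [h, Finset.sum_add_distrib, Finset.sum_sub_distrib, ← Finset.mul_sum,
    sum_rank_indicator ha hx, sum_rank_indicator hb hy, Finset.sum_const, Finset.card_univ,
    Fintype.card_fin, nsmul_eq_mul, Finset.sum_boole, empCopula,
    div_le_div_iff_of_pos_right hn', Nat.cast_le]
  field_simp
  ring

/-- The hypergeometric variance. As both families of centred rank indicators sum to zero, the error is
`n⁻¹ ∑ i, A i * B i` with `A`, `B` the centred indicators of the two coordinates, and the double sum
of the products of their covariances has, for variances `σ` and `τ`, `n` terms `σ τ` and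
`n (n - 1)` terms `σ τ / (n - 1)²`. -/
theorem integral_empCopula_sub_sq (ν : Measure (ℝ × ℝ)) [IsProbabilityMeasure ν]
    (hc : ContinuousMargins ν) (hi : Independence ν) {n a b : ℕ} (hn : 2 ≤ n) (ha : a ≤ n)
    (hb : b ≤ n) :
    ∫ z, (empCopula z ((a : ℝ) / n) ((b : ℝ) / n) - (a : ℝ) / n * ((b : ℝ) / n)) ^ 2
        ∂(sampleLaw ν n)
      = (a : ℝ) / n * (1 - (a : ℝ) / n) * ((b : ℝ) / n * (1 - (b : ℝ) / n)) / (n - 1) := by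
  have := nullSingletonClass_of_continuous_cdf _ hc.1
  have := nullSingletonClass_of_continuous_cdf _ hc.2
  have hn0 : (n : ℝ) ≠ 0 := by positivity
  have hn1 : (n : ℝ) - 1 ≠ 0 := by
    have : (2 : ℝ) ≤ n := by exact_mod_cast hn
    linarith
  set P := Measure.pi fun _ : Fin n => ν.fst with hP
  set Q := Measure.pi fun _ : Fin n => ν.snd with hQ
  have hmp : MeasurePreserving (MeasurableEquiv.arrowProdEquivProdArrow ℝ ℝ (Fin n))
      (sampleLaw ν n) (P.prod Q) := by
    have h := measurePreserving_arrowProdEquivProdArrow ℝ ℝ (Fin n) (fun _ => ν.fst)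
      (fun _ => ν.snd)
    rwa [← eq_prod_of_independence ν hi] at h
  have hinj : ∀ᵐ w ∂(P.prod Q), Function.Injective w.1 ∧ Function.Injective w.2 := by
    refine Eventually.and ?_ ?_
    · exact Measure.quasiMeasurePreserving_fst.ae (ae_injective ν.fst n)
    · exact Measure.quasiMeasurePreserving_snd.ae (ae_injective ν.snd n)
  have hinj' : ∀ᵐ z ∂(sampleLaw ν n),
      Function.Injective (fun k => (z k).1) ∧ Function.Injective (fun k => (z k).2) :=
    hmp.quasiMeasurePreserving.ae hinj
  have hcov : ∀ i j : Fin n, ∫ w : (Fin n → ℝ) × (Fin n → ℝ),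
      (centredRank a i w.1 * centredRank a j w.1) * (centredRank b i w.2 * centredRank b j w.2)
        ∂(P.prod Q) =
      if i = j then (a : ℝ) / n * (1 - (a : ℝ) / n) * ((b : ℝ) / n * (1 - (b : ℝ) / n))
      else (a : ℝ) / n * (1 - (a : ℝ) / n) * ((b : ℝ) / n * (1 - (b : ℝ) / n)) / (n - 1) ^ 2 := by
    intro i j
    rw [integral_prod_mul (fun x => centredRank a i x * centredRank a j x)
      (fun y => centredRank b i y * centredRank b j y)]
    split_ifs with hij
    · subst hij
      rw [integral_centredRank_sq _ ha, integral_centredRank_sq _ hb]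
    · rw [integral_centredRank_mul _ ha hij, integral_centredRank_mul _ hb hij]
      field_simp
  let Φ : (Fin n → ℝ) × (Fin n → ℝ) → ℝ := fun w => ∑ i, ∑ j,
    (centredRank a i w.1 * centredRank a j w.1) *
      (centredRank b i w.2 * centredRank b j w.2) / (n : ℝ) ^ 2
  calc
    _ = ∫ z, Φ (MeasurableEquiv.arrowProdEquivProdArrow ℝ ℝ (Fin n) z) ∂(sampleLaw ν n) := by
        refine integral_congr_ae ?_
        filter_upwards [hinj'] with z hz
        rw [empCopula_sub_eq (by omega) ha hb hz.1 hz.2, div_pow, sq (∑ i, _),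
          Finset.sum_mul_sum, Finset.sum_div]
        refine Finset.sum_congr rfl fun i _ => ?_
        rw [Finset.sum_div]
        refine Finset.sum_congr rfl fun j _ => ?_
        change _ = centredRank a i (fun k => (z k).1) * centredRank a j (fun k => (z k).1) *
          (centredRank b i (fun k => (z k).2) * centredRank b j (fun k => (z k).2)) / (n : ℝ) ^ 2
        ring
    _ = ∑ i : Fin n, ∑ j : Fin n, (if i = j then
          (a : ℝ) / n * (1 - (a : ℝ) / n) * ((b : ℝ) / n * (1 - (b : ℝ) / n))
        else (a : ℝ) / n * (1 - (a : ℝ) / n) * ((b : ℝ) / n * (1 - (b : ℝ) / n)) / (n - 1) ^ 2)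
          / (n : ℝ) ^ 2 := by
        have hint : ∀ i j : Fin n, Integrable (fun w : (Fin n → ℝ) × (Fin n → ℝ) =>
            (centredRank a i w.1 * centredRank a j w.1) *
              (centredRank b i w.2 * centredRank b j w.2) / (n : ℝ) ^ 2) (P.prod Q) := fun i j =>
          ((integrable_centredRank_mul ha i j P).mul_prod
            (integrable_centredRank_mul hb i j Q)).div_const _
        refine (hmp.integral_comp (MeasurableEquiv.measurableEmbedding _) Φ).trans ?_
        rw [integral_finsetSum _ fun i _ => integrable_finsetSum _ fun j _ => hint i j]
        refine Finset.sum_congr rfl fun i _ => ?_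
        rw [integral_finsetSum _ fun j _ => hint i j]
        refine Finset.sum_congr rfl fun j _ => ?_
        rw [integral_div, hcov]
    _ = _ := by
        have hrow : ∀ (A B : ℝ) (i : Fin n), ∑ j : Fin n, (if i = j then A else B) =
            A + (n - 1) * B := by
          intro A B i
          have : ∀ j : Fin n, (if i = j then A else B) = B + if i = j then A - B else 0 := by
            intro j; split_ifs <;> ring
          simp only [this, Finset.sum_add_distrib, Finset.sum_ite_eq, Finset.mem_univ, if_true,
            Finset.sum_const, Finset.card_univ, Fintype.card_fin, nsmul_eq_mul]
          ring
        simp only [← Finset.sum_div, hrow, Finset.sum_const, Finset.card_univ, Fintype.card_fin,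
          nsmul_eq_mul]
        field_simp
        ring

instance isProbabilityMeasure_sampleLaw (μ : Measure (ℝ × ℝ)) [IsProbabilityMeasure μ] (n : ℕ) :
    IsProbabilityMeasure (sampleLaw μ n) := by
  unfold sampleLaw; infer_instance

/-! ### Second moments of the interpolated empirical copula under independence -/

theorem measurable_empCopula {n : ℕ} (u v : ℝ) :
    Measurable fun z : Fin n → ℝ × ℝ => empCopula z u v := by
  simp only [empCopula, ← Finset.sum_boole]
  refine (Finset.measurable_sum _ fun i _ => ?_).div_const _
  have h1 : Measurable fun z : Fin n → ℝ × ℝ => (rank (fun k => (z k).1) i : ℝ) :=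
    (measurable_from_top (f := fun k : ℕ => (k : ℝ))).comp
      ((measurable_rank i).comp (measurable_pi_lambda _ fun k =>
        measurable_fst.comp (measurable_pi_apply k)))
  have h2 : Measurable fun z : Fin n → ℝ × ℝ => (rank (fun k => (z k).2) i : ℝ) :=
    (measurable_from_top (f := fun k : ℕ => (k : ℝ))).comp
      ((measurable_rank i).comp (measurable_pi_lambda _ fun k =>
        measurable_snd.comp (measurable_pi_apply k)))
  exact Measurable.ite ((measurableSet_le (h1.div_const _) measurable_const).inter
    (measurableSet_le (h2.div_const _) measurable_const)) measurable_const measurable_const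

theorem measurable_bilinearCopula {n : ℕ} (u v : ℝ) :
    Measurable fun z : Fin n → ℝ × ℝ => bilinearCopula z u v := by
  unfold bilinearCopula
  exact ((((measurable_empCopula _ _).const_mul _).add ((measurable_empCopula _ _).const_mul _)).add
    ((measurable_empCopula _ _).const_mul _)).add ((measurable_empCopula _ _).const_mul _)

theorem integrable_empCopula_sub_sq {n : ℕ} (μ : Measure (ℝ × ℝ)) [IsProbabilityMeasure μ]
    (u v c : ℝ) : Integrable (fun z : Fin n → ℝ × ℝ => (empCopula z u v - c) ^ 2)
      (sampleLaw μ n) := by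
  refine Integrable.of_bound
    (((measurable_empCopula u v).sub_const c).pow_const 2).aestronglyMeasurable ((1 + |c|) ^ 2)
    (Eventually.of_forall fun z => ?_)
  rw [norm_pow, Real.norm_eq_abs]
  gcongr
  refine (abs_sub _ _).trans ?_
  gcongr
  rw [abs_of_nonneg (empCopula_nonneg z u v)]
  exact empCopula_le_one z u v

theorem integrable_bilinearCopula_sub_sq {n : ℕ} (μ : Measure (ℝ × ℝ)) [IsProbabilityMeasure μ]
    {u v : ℝ} (hu : u ∈ Ioo (0 : ℝ) 1) (hv : v ∈ Ioo (0 : ℝ) 1) :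
    Integrable (fun z : Fin n → ℝ × ℝ => (bilinearCopula z u v - u * v) ^ 2)
      (sampleLaw μ n) := by
  refine Integrable.of_bound
    (((measurable_bilinearCopula u v).sub_const _).pow_const 2).aestronglyMeasurable 1
    (Eventually.of_forall fun z => ?_)
  rw [norm_pow, Real.norm_eq_abs]
  exact pow_le_one₀ (abs_nonneg _) (abs_bilinearCopula_sub_le z hu hv)

/-- The interpolation of the concave function `x ↦ x (1 - x)` lies below it. -/
theorem interp_variance_le {θ p p' u : ℝ} (hθ : θ ∈ Icc (0 : ℝ) 1)
    (hu : u = (1 - θ) * p + θ * p') :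
    (1 - θ) * (p * (1 - p)) + θ * (p' * (1 - p')) ≤ u * (1 - u) := by
  have h := mul_nonneg (mul_nonneg hθ.1 (sub_nonneg.2 hθ.2)) (sq_nonneg (p' - p))
  have e : u * (1 - u) - ((1 - θ) * (p * (1 - p)) + θ * (p' * (1 - p'))) =
      θ * (1 - θ) * (p' - p) ^ 2 := by
    rw [hu]; ring
  linarith

theorem floor_mul_add_one_le {n : ℕ} (hn : 0 < n) {u : ℝ} (hu : u < 1) :
    ⌊(n : ℝ) * u⌋₊ + 1 ≤ n := by
  have hn' : (0 : ℝ) < n := by positivity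
  have : ⌊(n : ℝ) * u⌋₊ < n := (Nat.floor_lt' (by omega)).2 (by nlinarith)
  omega

/-- Interpolation is exact for `(u, v) ↦ u v`, convex for the squared error, and does not increase
the product of the variances `p (1 - p)` at the nodes, so that the bound for the nodes extends to
all of `(0,1)²`. -/
theorem integral_bilinearCopula_sub_sq_le (ν : Measure (ℝ × ℝ)) [IsProbabilityMeasure ν]
    (hc : ContinuousMargins ν) (hi : Independence ν) {n : ℕ} (hn : 2 ≤ n) {u v : ℝ}
    (hu : u ∈ Ioo (0 : ℝ) 1) (hv : v ∈ Ioo (0 : ℝ) 1) :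
    ∫ z, (bilinearCopula z u v - u * v) ^ 2 ∂(sampleLaw ν n) ≤
      u * (1 - u) * (v * (1 - v)) / (n - 1) := by
  have hn0 : (n : ℝ) ≠ 0 := by positivity
  have hn1 : (0 : ℝ) < (n : ℝ) - 1 := by
    have : (2 : ℝ) ≤ n := by exact_mod_cast hn
    linarith
  have hi1 := floor_mul_add_one_le (by omega : 0 < n) hu.2
  have hj1 := floor_mul_add_one_le (by omega : 0 < n) hv.2
  have hθ := fract_weight_mem n hu.1.le
  have hτ := fract_weight_mem n hv.1.le
  have hform := fun z : Fin n → ℝ × ℝ => bilinearCopula_eq z u v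
  have hu' : u = (1 - (n * u - ⌊n * u⌋₊)) * ((⌊n * u⌋₊ : ℝ) / n)
      + (n * u - ⌊n * u⌋₊) * (((⌊n * u⌋₊ + 1 : ℕ) : ℝ) / n) := by
    push_cast; field_simp; ring
  have hv' : v = (1 - (n * v - ⌊n * v⌋₊)) * ((⌊n * v⌋₊ : ℝ) / n)
      + (n * v - ⌊n * v⌋₊) * (((⌊n * v⌋₊ + 1 : ℕ) : ℝ) / n) := by
    push_cast; field_simp; ring
  have m00 := integral_empCopula_sub_sq ν hc hi hn (Nat.le_of_succ_le hi1) (Nat.le_of_succ_le hj1)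
  have m10 := integral_empCopula_sub_sq ν hc hi hn hi1 (Nat.le_of_succ_le hj1)
  have m01 := integral_empCopula_sub_sq ν hc hi hn (Nat.le_of_succ_le hi1) hj1
  have m11 := integral_empCopula_sub_sq ν hc hi hn hi1 hj1
  simp only [← Nat.cast_add_one] at hform
  have hnode : ∀ {k : ℕ}, k ≤ n → (k : ℝ) / n ∈ Icc (0 : ℝ) 1 := fun hk =>
    ⟨by positivity, div_le_one_of_le₀ (by exact_mod_cast hk) (Nat.cast_nonneg _)⟩
  have hq := hnode (Nat.le_of_succ_le hj1)
  have hq' := hnode hj1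
  clear hnode
  generalize (n : ℝ) * u - ⌊(n : ℝ) * u⌋₊ = θ at *
  generalize (n : ℝ) * v - ⌊(n : ℝ) * v⌋₊ = τ at *
  generalize ((⌊(n : ℝ) * u⌋₊ + 1 : ℕ) : ℝ) / n = p' at *
  generalize ((⌊(n : ℝ) * v⌋₊ + 1 : ℕ) : ℝ) / n = q' at *
  generalize (⌊(n : ℝ) * u⌋₊ : ℝ) / n = p at *
  generalize (⌊(n : ℝ) * v⌋₊ : ℝ) / n = q at *
  have hpt : ∀ z : Fin n → ℝ × ℝ, (bilinearCopula z u v - u * v) ^ 2 ≤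
      (1 - θ) * (1 - τ) * (empCopula z p q - p * q) ^ 2
        + θ * (1 - τ) * (empCopula z p' q - p' * q) ^ 2
        + (1 - θ) * τ * (empCopula z p q' - p * q') ^ 2
        + θ * τ * (empCopula z p' q' - p' * q') ^ 2 := by
    intro z
    refine le_of_eq_of_le ?_ (bilinear_sq_le hθ hτ)
    rw [hform z, hu', hv']
    ring
  have i00 := (integrable_empCopula_sub_sq (n := n) ν p q (p * q)).const_mul ((1 - θ) * (1 - τ))
  have i10 := (integrable_empCopula_sub_sq (n := n) ν p' q (p' * q)).const_mul (θ * (1 - τ))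
  have i01 := (integrable_empCopula_sub_sq (n := n) ν p q' (p * q')).const_mul ((1 - θ) * τ)
  have i11 := (integrable_empCopula_sub_sq (n := n) ν p' q' (p' * q')).const_mul (θ * τ)
  refine (integral_mono (integrable_bilinearCopula_sub_sq ν hu hv)
    (((i00.add i10).add i01).add i11) hpt).trans ?_
  rw [integral_add' ((i00.add i10).add i01) i11, integral_add' (i00.add i10) i01,
    integral_add' i00 i10]
  simp only [integral_const_mul]
  rw [m00, m10, m01, m11]
  have hA := interp_variance_le hθ hu'
  have hB := interp_variance_le hτ hv'
  have hU : 0 ≤ u * (1 - u) := mul_nonneg hu.1.le (sub_nonneg.2 hu.2.le)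
  have hB0 : 0 ≤ (1 - τ) * (q * (1 - q)) + τ * (q' * (1 - q')) :=
    add_nonneg (mul_nonneg (sub_nonneg.2 hτ.2) (mul_nonneg hq.1 (sub_nonneg.2 hq.2)))
      (mul_nonneg hτ.1 (mul_nonneg hq'.1 (sub_nonneg.2 hq'.2)))
  refine le_of_eq_of_le ?_ (div_le_div_of_nonneg_right (mul_le_mul hA hB hB0 hU) hn1.le)
  ring

/-- The normalisation of `q̄_n` is exactly the one that makes this bound free of `u` and `v`. -/
theorem measureReal_le_abs_qBar_le (ν : Measure (ℝ × ℝ)) [IsProbabilityMeasure ν]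
    (hc : ContinuousMargins ν) (hi : Independence ν) {n : ℕ} (hn : 2 ≤ n) {u v : ℝ}
    (hu : u ∈ Ioo (0 : ℝ) 1) (hv : v ∈ Ioo (0 : ℝ) 1) {ε : ℝ} (hε : 0 < ε) :
    (sampleLaw ν n).real {z | ε * √(n : ℝ) ≤ |√(n : ℝ) * qBar z u v|} ≤
      1 / ((n - 1) * ε ^ 2) := by
  have hn0 : (0 : ℝ) < n := by positivity
  have hn1 : (0 : ℝ) < (n : ℝ) - 1 := by
    have : (2 : ℝ) ≤ n := by exact_mod_cast hn
    linarith
  have hw := sqrt_weight_pos hu hv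
  have hw2 := Real.sqrt_pos.1 hw
  have hsub : {z : Fin n → ℝ × ℝ | ε * √(n : ℝ) ≤ |√(n : ℝ) * qBar z u v|} ⊆
      {z | u * v * (1 - u) * (1 - v) * ε ^ 2 ≤ (bilinearCopula z u v - u * v) ^ 2} := by
    intro z hz
    simp only [mem_ofPred_eq] at hz ⊢
    rw [abs_mul, abs_of_nonneg (Real.sqrt_nonneg _), mul_comm,
      mul_le_mul_iff_right₀ (Real.sqrt_pos.2 hn0), qBar, abs_div, abs_of_pos hw,
      le_div_iff₀ hw] at hz
    have h := pow_le_pow_left₀ (by positivity) hz 2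
    rw [mul_pow, Real.sq_sqrt hw2.le, sq_abs] at h
    linarith
  have hmarkov := mul_meas_ge_le_integral_of_nonneg (μ := sampleLaw ν n)
    (f := fun z => (bilinearCopula z u v - u * v) ^ 2)
    (Eventually.of_forall fun z => sq_nonneg _) (integrable_bilinearCopula_sub_sq ν hu hv)
    (u * v * (1 - u) * (1 - v) * ε ^ 2)
  have h := hmarkov.trans (integral_bilinearCopula_sub_sq_le ν hc hi hn hu hv)
  refine (measureReal_mono hsub).trans ?_
  rw [le_div_iff₀ (by positivity)]
  rw [le_div_iff₀ hn1] at h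
  refine le_of_mul_le_mul_left ?_ hw2
  linarith

theorem measureReal_lt_testStat_le (ν : Measure (ℝ × ℝ)) [IsProbabilityMeasure ν]
    (hc : ContinuousMargins ν) (hi : Independence ν) {n s : ℕ} (hn : 2 ≤ n) {t : ℝ}
    (ht : t ∈ Ioo (0 : ℝ) 1) {ε : ℝ} (hε : 0 < ε) :
    (sampleLaw ν n).real {z | ε * √(n : ℝ) < testStat s t z} ≤
      gridCard s / ((n - 1) * ε ^ 2) := by
  have hsub : {z : Fin n → ℝ × ℝ | ε * √(n : ℝ) < testStat s t z} ⊆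
      ⋃ k, {z | ε * √(n : ℝ) ≤ gridValues s z k} := by
    intro z hz
    by_contra hcon
    simp only [mem_iUnion, mem_ofPred_eq, not_exists, not_le] at hcon hz
    exact absurd (testStat_le ht fun k => (hcon k).le) (not_le.2 hz)
  refine (measureReal_mono hsub).trans ((measureReal_iUnion_fintype_le _).trans ?_)
  have hk : ∀ k ∈ (Finset.univ : Finset (Fin (gridCard s))),
      (sampleLaw ν n).real {z | ε * √(n : ℝ) ≤ gridValues s z k} ≤ 1 / ((n - 1) * ε ^ 2) :=
    fun k _ => measureReal_le_abs_qBar_le ν hc hi hn (gridPoint_mem s (finProdFinEquiv.symm k).1)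
      (gridPoint_mem s (finProdFinEquiv.symm k).2) hε
  refine (Finset.sum_le_card_nsmul _ _ _ hk).trans_eq ?_
  rw [Finset.card_univ, Fintype.card_fin, nsmul_eq_mul, mul_one_div]

/-! ### The critical value -/

/-- A negative threshold is exceeded with probability one, under any law satisfying the
hypothesis. -/
theorem nonneg_of_admissible {s n : ℕ} {t α : ℝ} (ht : t ∈ Ioo (0 : ℝ) 1) (hα : α < 1)
    (ν : Measure (ℝ × ℝ)) [IsProbabilityMeasure ν] (hc : ContinuousMargins ν)
    (hi : Independence ν) {c : ℝ}
    (h : ∀ ν : Measure (ℝ × ℝ), IsProbabilityMeasure ν → ContinuousMargins ν →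
      Independence ν → (sampleLaw ν n).real {z | c < testStat s t z} ≤ α) : 0 ≤ c := by
  by_contra hneg
  have huniv : {z : Fin n → ℝ × ℝ | c < testStat s t z} = univ :=
    eq_univ_of_forall fun z => (not_le.1 hneg).trans_le (testStat_nonneg ht z)
  have := h ν inferInstance hc hi
  rw [huniv, probReal_univ] at this
  linarith

/-- The infimum defining the critical value is attained: the thresholds that respect the level are
closed upwards, and `c ↦ P(T_n > c)` is continuous from the right. -/
theorem measureReal_rejectionRegion_le (s n : ℕ) {t α : ℝ} (ht : t ∈ Ioo (0 : ℝ) 1)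
    (hα : α ∈ Ioo (0 : ℝ) 1) (ν : Measure (ℝ × ℝ)) [IsProbabilityMeasure ν]
    (hc : ContinuousMargins ν) (hi : Independence ν) :
    (sampleLaw ν n).real (rejectionRegion s t n α) ≤ α := by
  have hne : {c : ℝ | ∀ ν : Measure (ℝ × ℝ), IsProbabilityMeasure ν → ContinuousMargins ν →
      Independence ν → (sampleLaw ν n).real {z | c < testStat s t z} ≤ α}.Nonempty := by
    obtain ⟨B, hB⟩ := exists_testStat_le s n ht
    refine ⟨B, fun ν' _ _ _ => ?_⟩
    have : {z : Fin n → ℝ × ℝ | B < testStat s t z} = ∅ :=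
      eq_empty_of_forall_notMem fun z hz => absurd (hB z) (not_le.2 hz)
    rw [this, measureReal_empty]
    exact hα.1.le
  have hstep : ∀ k : ℕ, sampleLaw ν n
      {z | criticalValue s t n α + 1 / ((k : ℝ) + 1) < testStat s t z} ≤ ENNReal.ofReal α := by
    intro k
    obtain ⟨c, hcS, hlt⟩ := exists_lt_of_csInf_lt hne
      (lt_add_of_pos_right (criticalValue s t n α) (Nat.one_div_pos_of_nat (n := k)))
    rw [← ofReal_measureReal]
    exact ENNReal.ofReal_le_ofReal ((measureReal_mono fun z hz => lt_trans hlt hz).trans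
      (hcS ν inferInstance hc hi))
  have hunion : rejectionRegion s t n α =
      ⋃ k : ℕ, {z | criticalValue s t n α + 1 / ((k : ℝ) + 1) < testStat s t z} := by
    ext z
    simp only [rejectionRegion, mem_ofPred_eq, mem_iUnion]
    constructor
    · intro hz
      obtain ⟨k, hk⟩ := exists_nat_one_div_lt (sub_pos.2 hz)
      exact ⟨k, by linarith⟩
    · rintro ⟨k, hk⟩
      exact (lt_add_of_pos_right _ Nat.one_div_pos_of_nat).trans hk
  have hmono : Monotone fun k : ℕ =>
      {z : Fin n → ℝ × ℝ | criticalValue s t n α + 1 / ((k : ℝ) + 1) < testStat s t z} := by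
    intro k l hkl z hz
    refine lt_of_le_of_lt ?_ (show criticalValue s t n α + 1 / ((k : ℝ) + 1) < _ from hz)
    have := Nat.one_div_le_one_div (α := ℝ) hkl
    linarith
  refine ENNReal.toReal_le_of_le_ofReal hα.1.le ?_
  rw [hunion, hmono.measure_iUnion]
  exact iSup_le hstep

theorem criticalValue_le {s n : ℕ} {t α ε : ℝ} (ht : t ∈ Ioo (0 : ℝ) 1) (hα : α < 1)
    (hn : 2 ≤ n) (hε : 0 < ε) (hsmall : gridCard s / (((n : ℝ) - 1) * ε ^ 2) ≤ α)
    (ν : Measure (ℝ × ℝ)) [IsProbabilityMeasure ν] (hc : ContinuousMargins ν)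
    (hi : Independence ν) : criticalValue s t n α ≤ ε * √(n : ℝ) := by
  refine csInf_le ⟨0, fun c h => nonneg_of_admissible ht hα ν hc hi h⟩ ?_
  intro ν' _ hc' hi'
  exact (measureReal_lt_testStat_le ν' hc' hi' hn ht hε).trans hsmall

/-- Together with `continuousMargins_prod`, this shows that the laws over which the critical value is
defined are not an empty family as soon as some law has continuous margins. -/
theorem independence_prod (μ : Measure (ℝ × ℝ)) [IsProbabilityMeasure μ] :
    Independence (μ.fst.prod μ.snd) := by
  intro x y
  rw [jointCdf, measureReal_prod_prod, Measure.fst_prod, Measure.snd_prod, cdf_eq_real,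
    cdf_eq_real]

theorem continuousMargins_prod (μ : Measure (ℝ × ℝ)) [IsProbabilityMeasure μ]
    (h : ContinuousMargins μ) : ContinuousMargins (μ.fst.prod μ.snd) := by
  unfold ContinuousMargins
  rwa [Measure.fst_prod, Measure.snd_prod]

/-! ### Consistency of the empirical copula at one point -/

/-- Weak law of large numbers for the relative frequency of a set, with Chebyshev's rate. -/
theorem measureReal_le_abs_freq_sub_le (μ : Measure (ℝ × ℝ)) [IsProbabilityMeasure μ]
    {S : Set (ℝ × ℝ)} (hS : MeasurableSet S) {n : ℕ} (hn : 0 < n) {ε : ℝ} (hε : 0 < ε) :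
    (sampleLaw μ n).real {z | ε ≤ |(∑ i, S.indicator (fun _ => (1 : ℝ)) (z i)) / n - μ.real S|} ≤
      1 / (n * ε ^ 2) := by
  have hn0 : (0 : ℝ) < n := by exact_mod_cast hn
  have hmeas : Measurable (S.indicator (fun _ => (1 : ℝ))) := measurable_const.indicator hS
  have hL : MemLp (S.indicator (fun _ => (1 : ℝ))) 2 μ :=
    (memLp_const (1 : ℝ)).indicator hS
  have hLi : ∀ i : Fin n, MemLp (fun z : Fin n → ℝ × ℝ => S.indicator (fun _ => (1 : ℝ)) (z i)) 2
      (sampleLaw μ n) := fun i =>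
    hL.comp_measurePreserving (measurePreserving_eval (fun _ : Fin n => μ) i)
  have hsum : MemLp (∑ i : Fin n, fun z : Fin n → ℝ × ℝ => S.indicator (fun _ => (1 : ℝ)) (z i)) 2
      (sampleLaw μ n) := memLp_finsetSum' _ fun i _ => hLi i
  have hvar : Var[∑ i : Fin n, fun z : Fin n → ℝ × ℝ => S.indicator (fun _ => (1 : ℝ)) (z i);
      sampleLaw μ n] ≤ n := by
    rw [sampleLaw, variance_sum_pi fun _ => hL, Finset.sum_const, Finset.card_univ,
      Fintype.card_fin, nsmul_eq_mul]
    refine mul_le_of_le_one_right hn0.le ?_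
    refine (variance_le_expectation_sq hmeas.aestronglyMeasurable).trans ?_
    have h1 : ∫ x, (1 : ℝ) ∂μ = 1 := by simp
    rw [← h1]
    refine integral_mono_of_nonneg (Eventually.of_forall fun x => sq_nonneg _)
      (integrable_const _) (Eventually.of_forall fun x => ?_)
    by_cases hx : x ∈ S <;> simp [hx]
  have hmean : ∫ z, (∑ i : Fin n, fun z : Fin n → ℝ × ℝ => S.indicator (fun _ => (1 : ℝ)) (z i)) z
      ∂(sampleLaw μ n) = n * μ.real S := by
    simp only [Finset.sum_apply]
    rw [integral_finsetSum _ fun i _ => (hLi i).integrable one_le_two]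
    have : ∀ i : Fin n, ∫ z : Fin n → ℝ × ℝ, S.indicator (fun _ => (1 : ℝ)) (z i)
        ∂(sampleLaw μ n) = μ.real S := by
      intro i
      have h := integral_map (μ := sampleLaw μ n) (measurable_pi_apply i).aemeasurable
        (f := S.indicator (fun _ => (1 : ℝ))) hmeas.aestronglyMeasurable
      rw [← h, sampleLaw, (measurePreserving_eval (fun _ : Fin n => μ) i).map_eq,
        integral_indicator hS]
      simp
    simp [this]
  have hcheb := meas_ge_le_variance_div_sq hsum (mul_pos hn0 hε)
  rw [hmean] at hcheb
  have hset : {z : Fin n → ℝ × ℝ | ε ≤ |(∑ i, S.indicator (fun _ => (1 : ℝ)) (z i)) / n - μ.real S|}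
      ⊆ {z | n * ε ≤ |(∑ i : Fin n, fun z : Fin n → ℝ × ℝ =>
        S.indicator (fun _ => (1 : ℝ)) (z i)) z - n * μ.real S|} := by
    intro z hz
    simp only [mem_ofPred_eq, Finset.sum_apply] at hz ⊢
    have e : (∑ i, S.indicator (fun _ => (1 : ℝ)) (z i)) - n * μ.real S =
        n * ((∑ i, S.indicator (fun _ => (1 : ℝ)) (z i)) / n - μ.real S) := by
      field_simp
    rw [e, abs_mul, abs_of_pos hn0]
    exact mul_le_mul_of_nonneg_left hz hn0.le
  refine (measureReal_mono hset).trans ?_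
  refine (ENNReal.toReal_le_of_le_ofReal (div_nonneg (variance_nonneg _ _) (sq_nonneg _))
    hcheb).trans ?_
  refine (div_le_div_of_nonneg_right hvar (sq_nonneg _)).trans_eq ?_
  field_simp

theorem abs_card_inter_sub_card_inter_le {ι : Type*} [DecidableEq ι] {A B A' B' : Finset ι}
    (h : A ⊆ B ∨ B ⊆ A) (h' : A' ⊆ B' ∨ B' ⊆ A') :
    |((A ∩ A').card : ℝ) - (B ∩ B').card| ≤
      |(A.card : ℝ) - B.card| + |(A'.card : ℝ) - B'.card| := by
  -- for nested sets the cardinality of the difference is the positive part of the difference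
  have hdiff : ∀ {C D : Finset ι}, C ⊆ D ∨ D ⊆ C →
      ((C \ D).card : ℝ) ≤ |(C.card : ℝ) - D.card| := by
    rintro C D (hCD | hDC)
    · rw [Finset.sdiff_eq_empty_iff_subset.2 hCD]
      simp
    · rw [Finset.card_sdiff_of_subset hDC, Nat.cast_sub (Finset.card_le_card hDC)]
      exact le_abs_self _
  have hinter : ∀ C D C' D' : Finset ι,
      ((C ∩ C').card : ℝ) ≤ (D ∩ D').card + (C \ D).card + (C' \ D').card := by
    intro C D C' D'
    have hsub : C ∩ C' ⊆ (D ∩ D') ∪ (C \ D) ∪ (C' \ D') := by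
      intro i hi
      simp only [Finset.mem_inter, Finset.mem_union, Finset.mem_sdiff] at hi ⊢
      tauto
    have hcard := (Finset.card_le_card hsub).trans ((Finset.card_union_le _ _).trans
      (Nat.add_le_add_right (Finset.card_union_le _ _) _))
    exact_mod_cast hcard
  have h1 := hinter A B A' B'
  have h2 := hinter B A B' A'
  have h3 := hdiff h
  have h4 := hdiff h'
  have h5 := hdiff h.symm
  have h6 := hdiff h'.symm
  rw [abs_sub_comm] at h5 h6
  rw [abs_le]
  constructor <;> linarith

/-- Without ties exactly `⌊n u⌋` observations have normalised rank at most `u`. -/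
theorem card_rank_div_le {n : ℕ} (hn : 0 < n) {x : Fin n → ℝ} (hx : Function.Injective x) {u : ℝ}
    (hu : u ∈ Icc (0 : ℝ) 1) :
    (Finset.univ.filter fun i => (rank x i : ℝ) / n ≤ u).card = ⌊(n : ℝ) * u⌋₊ := by
  have hn0 : (0 : ℝ) < n := by exact_mod_cast hn
  have hle : ⌊(n : ℝ) * u⌋₊ ≤ n := Nat.floor_le_of_le (mul_le_of_le_one_right hn0.le hu.2)
  rw [← card_rank_le hx hle]
  congr 1
  ext i
  simp only [Finset.mem_filter, Finset.mem_univ, true_and]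
  rw [div_le_iff₀ hn0, mul_comm, Nat.le_floor_iff (mul_nonneg hn0.le hu.1)]

/-- Both sets are initial segments of the sample ordered by size. -/
theorem rank_filter_nested {n : ℕ} (x : Fin n → ℝ) (u x₀ : ℝ) :
    (Finset.univ.filter fun i => (rank x i : ℝ) / n ≤ u) ⊆ (Finset.univ.filter fun i => x i ≤ x₀) ∨
    (Finset.univ.filter fun i => x i ≤ x₀) ⊆
      (Finset.univ.filter fun i => (rank x i : ℝ) / n ≤ u) := by
  by_contra! hcon
  obtain ⟨h1, h2⟩ := hcon
  obtain ⟨i, hi, hi'⟩ := Finset.not_subset.1 h1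
  obtain ⟨j, hj, hj'⟩ := Finset.not_subset.1 h2
  simp only [Finset.mem_filter, Finset.mem_univ, true_and, not_le] at hi hi' hj hj'
  have hr : (rank x j : ℝ) ≤ rank x i := by exact_mod_cast rank_mono x (hj.trans hi'.le)
  have : (rank x j : ℝ) / n ≤ rank x i / n := by gcongr
  linarith

theorem abs_card_rank_sub_le {n : ℕ} (hn : 0 < n) {x : Fin n → ℝ} (hx : Function.Injective x)
    {u x₀ : ℝ} (hu : u ∈ Icc (0 : ℝ) 1) :
    |((Finset.univ.filter fun i => (rank x i : ℝ) / n ≤ u).card : ℝ)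
      - (Finset.univ.filter fun i => x i ≤ x₀).card| ≤
      n * |((Finset.univ.filter fun i => x i ≤ x₀).card : ℝ) / n - u| + 1 := by
  have hn0 : (0 : ℝ) < n := by exact_mod_cast hn
  rw [card_rank_div_le hn hx hu]
  have h1 := fract_weight_mem n hu.1
  have e : ∀ c : ℝ, n * |c / n - u| = |c - n * u| := by
    intro c
    rw [← abs_of_pos hn0, ← abs_mul, abs_of_pos hn0]
    congr 1
    field_simp
  rw [e, abs_sub_comm]
  refine (abs_sub_le _ ((n : ℝ) * u) _).trans ?_
  gcongr
  rw [abs_of_nonneg h1.1]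
  exact h1.2

theorem abs_empCopula_sub_freq_le {n : ℕ} (hn : 0 < n) {z : Fin n → ℝ × ℝ}
    (hx : Function.Injective fun k => (z k).1) (hy : Function.Injective fun k => (z k).2)
    {u v x₀ y₀ : ℝ} (hu : u ∈ Icc (0 : ℝ) 1) (hv : v ∈ Icc (0 : ℝ) 1) :
    |empCopula z u v
      - ((Finset.univ.filter fun i => (z i).1 ≤ x₀ ∧ (z i).2 ≤ y₀).card : ℝ) / n| ≤
      |((Finset.univ.filter fun i => (z i).1 ≤ x₀).card : ℝ) / n - u|
        + |((Finset.univ.filter fun i => (z i).2 ≤ y₀).card : ℝ) / n - v| + 2 / n := by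
  have hn0 : (0 : ℝ) < n := by exact_mod_cast hn
  have h := abs_card_inter_sub_card_inter_le (rank_filter_nested (fun k => (z k).1) u x₀)
    (rank_filter_nested (fun k => (z k).2) v y₀)
  have h1 := abs_card_rank_sub_le hn hx (x₀ := x₀) hu
  have h2 := abs_card_rank_sub_le hn hy (x₀ := y₀) hv
  rw [← Finset.filter_and, ← Finset.filter_and] at h
  rw [empCopula, ← sub_div, abs_div, abs_of_pos hn0, div_le_iff₀ hn0]
  have e : ∀ a b : ℝ, (a + b + 2 / n) * n = n * a + n * b + 2 := by
    intro a b; field_simp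
  rw [e]
  linarith

theorem ae_injective_fst_snd (μ : Measure (ℝ × ℝ)) [IsProbabilityMeasure μ]
    (hc : ContinuousMargins μ) (n : ℕ) :
    ∀ᵐ z ∂(sampleLaw μ n),
      Function.Injective (fun k => (z k).1) ∧ Function.Injective (fun k => (z k).2) := by
  have := nullSingletonClass_of_continuous_cdf _ hc.1
  have := nullSingletonClass_of_continuous_cdf _ hc.2
  have h1 : MeasurePreserving (fun (z : Fin n → ℝ × ℝ) k => (z k).1) (sampleLaw μ n)
      (Measure.pi fun _ => μ.fst) :=
    measurePreserving_pi (fun _ => μ) (fun _ => μ.fst) fun _ => ⟨measurable_fst, rfl⟩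
  have h2 : MeasurePreserving (fun (z : Fin n → ℝ × ℝ) k => (z k).2) (sampleLaw μ n)
      (Measure.pi fun _ => μ.snd) :=
    measurePreserving_pi (fun _ => μ) (fun _ => μ.snd) fun _ => ⟨measurable_snd, rfl⟩
  exact (h1.quasiMeasurePreserving.ae (ae_injective μ.fst n)).and
    (h2.quasiMeasurePreserving.ae (ae_injective μ.snd n))

theorem measureReal_lt_abs_empCopula_sub_le (μ : Measure (ℝ × ℝ)) [IsProbabilityMeasure μ]
    (hc : ContinuousMargins μ) (x₀ y₀ : ℝ) {n : ℕ} (hn : 0 < n) {ε : ℝ} (hε : 0 < ε) :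
    (sampleLaw μ n).real {z | 3 * ε + 2 / n <
      |empCopula z (cdf μ.fst x₀) (cdf μ.snd y₀) - jointCdf μ x₀ y₀|} ≤ 3 / (n * ε ^ 2) := by
  have hu : cdf μ.fst x₀ ∈ Icc (0 : ℝ) 1 := ⟨cdf_nonneg _ _, cdf_le_one _ _⟩
  have hv : cdf μ.snd y₀ ∈ Icc (0 : ℝ) 1 := ⟨cdf_nonneg _ _, cdf_le_one _ _⟩
  have mX : MeasurableSet {p : ℝ × ℝ | p.1 ≤ x₀} := measurableSet_le measurable_fst measurable_const
  have mY : MeasurableSet {p : ℝ × ℝ | p.2 ≤ y₀} := measurableSet_le measurable_snd measurable_const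
  have mXY : MeasurableSet {p : ℝ × ℝ | p.1 ≤ x₀ ∧ p.2 ≤ y₀} := mX.inter mY
  have hF : cdf μ.fst x₀ = μ.real {p : ℝ × ℝ | p.1 ≤ x₀} := by
    rw [cdf_eq_real, Measure.real, Measure.fst_apply measurableSet_Iic]; rfl
  have hG : cdf μ.snd y₀ = μ.real {p : ℝ × ℝ | p.2 ≤ y₀} := by
    rw [cdf_eq_real, Measure.real, Measure.snd_apply measurableSet_Iic]; rfl
  have hH : jointCdf μ x₀ y₀ = μ.real {p : ℝ × ℝ | p.1 ≤ x₀ ∧ p.2 ≤ y₀} := rfl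
  have hcount : ∀ (p : ℝ × ℝ → Prop) [DecidablePred p] (z : Fin n → ℝ × ℝ),
      ∑ i, {q | p q}.indicator (fun _ => (1 : ℝ)) (z i) =
        ((Finset.univ.filter fun i => p (z i)).card : ℝ) := by
    intro p _ z
    rw [← Finset.sum_boole]
    exact Finset.sum_congr rfl fun i _ => by simp [indicator_apply]
  have b1 := measureReal_le_abs_freq_sub_le μ mX hn hε
  have b2 := measureReal_le_abs_freq_sub_le μ mY hn hε
  have b3 := measureReal_le_abs_freq_sub_le μ mXY hn hε
  simp only [hcount, ← hF, ← hG, ← hH] at b1 b2 b3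
  set S₁ := {z : Fin n → ℝ × ℝ | ε ≤
    |((Finset.univ.filter fun i => (z i).1 ≤ x₀).card : ℝ) / n - cdf μ.fst x₀|}
  set S₂ := {z : Fin n → ℝ × ℝ | ε ≤
    |((Finset.univ.filter fun i => (z i).2 ≤ y₀).card : ℝ) / n - cdf μ.snd y₀|}
  set S₃ := {z : Fin n → ℝ × ℝ | ε ≤
    |((Finset.univ.filter fun i => (z i).1 ≤ x₀ ∧ (z i).2 ≤ y₀).card : ℝ) / n - jointCdf μ x₀ y₀|}
  set N := {z : Fin n → ℝ × ℝ |
    ¬ (Function.Injective (fun k => (z k).1) ∧ Function.Injective (fun k => (z k).2))}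
  have hN : (sampleLaw μ n).real N = 0 := by
    rw [measureReal_eq_zero_iff]
    exact ae_iff.1 (ae_injective_fst_snd μ hc n)
  have hsub : {z | 3 * ε + 2 / n <
      |empCopula z (cdf μ.fst x₀) (cdf μ.snd y₀) - jointCdf μ x₀ y₀|} ⊆ N ∪ S₁ ∪ S₂ ∪ S₃ := by
    intro z hz
    by_contra hcon
    simp only [mem_union, not_or] at hcon
    obtain ⟨⟨⟨h0, h1⟩, h2⟩, h3⟩ := hcon
    have hinj := not_not.1 h0
    simp only [S₁, S₂, S₃, mem_ofPred_eq, not_le] at h1 h2 h3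
    have h4 := abs_empCopula_sub_freq_le hn hinj.1 hinj.2 (x₀ := x₀) (y₀ := y₀) hu hv
    have h5 := abs_sub_le (empCopula z (cdf μ.fst x₀) (cdf μ.snd y₀))
      (((Finset.univ.filter fun i => (z i).1 ≤ x₀ ∧ (z i).2 ≤ y₀).card : ℝ) / n)
      (jointCdf μ x₀ y₀)
    have hz' : 3 * ε + 2 / n <
      |empCopula z (cdf μ.fst x₀) (cdf μ.snd y₀) - jointCdf μ x₀ y₀| := hz
    linarith
  have e : (3 : ℝ) / (n * ε ^ 2) = 0 + 1 / (n * ε ^ 2) + 1 / (n * ε ^ 2) + 1 / (n * ε ^ 2) := by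
    ring
  rw [e]
  refine (measureReal_mono hsub).trans ((measureReal_union_le _ _).trans ?_)
  refine add_le_add ((measureReal_union_le _ _).trans ?_) b3
  refine add_le_add ((measureReal_union_le _ _).trans ?_) b2
  exact add_le_add hN.le b1

/-! ### Growth of the statistic under dependence -/

/-- Dependence shows at a point where both margins are nondegenerate. -/
theorem exists_jointCdf_ne (μ : Measure (ℝ × ℝ)) [IsProbabilityMeasure μ] (h : ¬ Independence μ) :
    ∃ x y, cdf μ.fst x ∈ Ioo (0 : ℝ) 1 ∧ cdf μ.snd y ∈ Ioo (0 : ℝ) 1 ∧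
      jointCdf μ x y ≠ cdf μ.fst x * cdf μ.snd y := by
  unfold Independence at h
  push Not at h
  obtain ⟨x, y, hxy⟩ := h
  have my : MeasurableSet (Prod.snd ⁻¹' Iic y : Set (ℝ × ℝ)) := measurable_snd measurableSet_Iic
  have hF : cdf μ.fst x = μ.real (Prod.fst ⁻¹' Iic x) := by
    rw [cdf_eq_real, Measure.real, Measure.fst_apply measurableSet_Iic]; rfl
  have hG : cdf μ.snd y = μ.real (Prod.snd ⁻¹' Iic y) := by
    rw [cdf_eq_real, Measure.real, Measure.snd_apply measurableSet_Iic]; rfl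
  have hH : jointCdf μ x y = μ.real (Prod.fst ⁻¹' Iic x ∩ Prod.snd ⁻¹' Iic y) := rfl
  -- the Fréchet–Hoeffding bounds
  have hHF : jointCdf μ x y ≤ cdf μ.fst x := by
    rw [hH, hF]; exact measureReal_mono inter_subset_left
  have hHG : jointCdf μ x y ≤ cdf μ.snd y := by
    rw [hH, hG]; exact measureReal_mono inter_subset_right
  have hlow : cdf μ.fst x + cdf μ.snd y - 1 ≤ jointCdf μ x y := by
    have := measureReal_union_add_inter (μ := μ) (s := Prod.fst ⁻¹' Iic x) my
    have h1 : μ.real (Prod.fst ⁻¹' Iic x ∪ Prod.snd ⁻¹' Iic y) ≤ 1 := measureReal_le_one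
    rw [hH, hF, hG]
    linarith
  have hH0 : 0 ≤ jointCdf μ x y := measureReal_nonneg
  have f0 := cdf_nonneg μ.fst x
  have f1 := cdf_le_one μ.fst x
  have g0 := cdf_nonneg μ.snd y
  have g1 := cdf_le_one μ.snd y
  refine ⟨x, y, ⟨f0.lt_of_ne fun e => hxy ?_, f1.lt_of_ne fun e => hxy ?_⟩,
    ⟨g0.lt_of_ne fun e => hxy ?_, g1.lt_of_ne fun e => hxy ?_⟩, hxy⟩
  · rw [← e] at hHF ⊢; linarith
  · rw [e] at hlow ⊢; linarith
  · rw [← e] at hHG ⊢; linarith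
  · rw [e] at hlow ⊢; linarith

/-- By monotonicity, a deviation of the empirical copula from `u v` at one point forces a deviation
of its interpolation on a whole square, to the upper right of the point if the deviation is upwards
and to its lower left if it is downwards. -/
theorem exists_square {u₀ v₀ h : ℝ} (hu : u₀ ∈ Ioo (0 : ℝ) 1) (hv : v₀ ∈ Ioo (0 : ℝ) 1)
    (hne : h ≠ u₀ * v₀) :
    ∃ δ > 0, ∃ a b a' b' : ℝ, 0 < a ∧ a < b ∧ b < 1 ∧ 0 < a' ∧ a' < b' ∧ b' < 1 ∧ ∃ N : ℕ,
      ∀ n ≥ N, ∀ z : Fin n → ℝ × ℝ, |empCopula z u₀ v₀ - h| ≤ δ →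
        ∀ u ∈ Icc a b, ∀ v ∈ Icc a' b', δ ≤ |bilinearCopula z u v - u * v| := by
  obtain ⟨hu0, hu1⟩ := hu
  obtain ⟨hv0, hv1⟩ := hv
  have habs : 0 < |h - u₀ * v₀| := abs_pos.2 (sub_ne_zero.2 hne)
  -- `η` keeps the square inside `(0,1)²` and the variation of `u v` on it below a third of the
  -- deviation; beyond `N` the cells of the interpolation are narrower than `η / 2`
  obtain ⟨η, hη, h1, h2, h3, h4, h5⟩ : ∃ η > 0, η < 1 - u₀ ∧ η < 1 - v₀ ∧ η < u₀ ∧ η < v₀ ∧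
      3 * η ≤ |h - u₀ * v₀| / 3 := by
    have hpos : 0 < min (min (1 - u₀) (1 - v₀)) (min (min u₀ v₀) (|h - u₀ * v₀| / 9)) :=
      lt_min (lt_min (by linarith) (by linarith)) (lt_min (lt_min hu0 hv0) (by linarith))
    obtain ⟨η, hη0, hη1⟩ := exists_between hpos
    simp only [lt_min_iff] at hη1
    exact ⟨η, hη0, hη1.1.1, hη1.1.2, hη1.2.1.1, hη1.2.1.2, by linarith [hη1.2.2]⟩
  obtain ⟨N, hN⟩ := exists_nat_gt (2 / η)
  have hbound : ∀ n ≥ N, (0 : ℝ) < n ∧ 1 < η / 2 * n := by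
    intro n hn
    have hn' : 2 / η < n := hN.trans_le (by exact_mod_cast hn)
    have h2η : 0 < 2 / η := by positivity
    refine ⟨h2η.trans hn', ?_⟩
    rw [div_lt_iff₀ hη] at hn'
    linarith
  refine ⟨|h - u₀ * v₀| / 3, by positivity, ?_⟩
  rcases lt_or_gt_of_ne hne with hlt | hgt
  · rw [abs_of_neg (by linarith)] at h5 ⊢
    refine ⟨u₀ - η, u₀ - η / 2, v₀ - η, v₀ - η / 2, by linarith, by linarith, by linarith,
      by linarith, by linarith, by linarith, N, ?_⟩
    intro n hn z hz u hu v hv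
    obtain ⟨hn0, hn1⟩ := hbound n hn
    have hu0' : 0 ≤ u := by linarith [hu.1]
    have hv0' : 0 ≤ v := by linarith [hv.1]
    have hcell : ∀ {w w₀ : ℝ}, 0 ≤ w → w ≤ w₀ - η / 2 → ((⌊(n : ℝ) * w⌋₊ : ℝ) + 1) / n ≤ w₀ := by
      intro w w₀ hw hw'
      rw [div_le_iff₀ hn0]
      have := Nat.floor_le (mul_nonneg hn0.le hw)
      nlinarith
    have hle := (bilinearCopula_le z hu0' hv0').trans
      (empCopula_mono z (hcell hu0' hu.2) (hcell hv0' hv.2))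
    have hprod : (u₀ - η) * (v₀ - η) ≤ u * v :=
      mul_le_mul hu.1 hv.1 (by linarith) hu0'
    have hz' := abs_le.1 hz
    refine le_trans ?_ (neg_le_abs _)
    nlinarith
  · rw [abs_of_pos (by linarith)] at h5 ⊢
    refine ⟨u₀ + η / 2, u₀ + η, v₀ + η / 2, v₀ + η, by linarith, by linarith, by linarith,
      by linarith, by linarith, by linarith, N, ?_⟩
    intro n hn z hz u hu v hv
    obtain ⟨hn0, hn1⟩ := hbound n hn
    have hu0' : 0 ≤ u := by linarith [hu.1]
    have hv0' : 0 ≤ v := by linarith [hv.1]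
    have hcell : ∀ {w w₀ : ℝ}, w₀ + η / 2 ≤ w → w₀ ≤ (⌊(n : ℝ) * w⌋₊ : ℝ) / n := by
      intro w w₀ hw'
      rw [le_div_iff₀ hn0]
      have := Nat.lt_floor_add_one ((n : ℝ) * w)
      nlinarith
    have hle := (empCopula_mono z (hcell hu.1) (hcell hv.1)).trans (le_bilinearCopula z hu0' hv0')
    have hprod : u * v ≤ (u₀ + η) * (v₀ + η) :=
      mul_le_mul hu.2 hv.2 hv0' (by linarith)
    have hz' := abs_le.1 hz
    refine le_trans ?_ (le_abs_self _)
    nlinarith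

theorem le_testStat_of_square {n s : ℕ} {t : ℝ} (ht : t ∈ Ioo (0 : ℝ) 1) {z : Fin n → ℝ × ℝ}
    {a b a' b' δ : ℝ} (ha : 0 < a) (hab : a < b) (hb : b < 1) (ha' : 0 < a') (hab' : a' < b')
    (hb' : b' < 1) (hδ : 0 < δ) (hs : 2 ≤ (b - a) * 2 ^ (s + 1)) (hs' : 2 ≤ (b' - a') * 2 ^ (s + 1))
    (h : ∀ u ∈ Icc a b, ∀ v ∈ Icc a' b', δ ≤ |bilinearCopula z u v - u * v|) :
    δ * ((b - a) / 2 * ((b' - a') / 2)) * √(n : ℝ) ≤ testStat s t z := by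
  refine le_trans ?_ (mean_le_testStat ht z)
  have hK : (0 : ℝ) < gridCard s := by exact_mod_cast gridCard_pos s
  have hm : (0 : ℝ) < 2 ^ (s + 1) := by positivity
  rw [le_div_iff₀ hK]
  have hKle : (gridCard s : ℝ) ≤ 2 ^ (s + 1) * 2 ^ (s + 1) := by
    have : (gridSize s : ℝ) ≤ 2 ^ (s + 1) := by rw [gridSize_cast]; linarith
    rw [gridCard, Nat.cast_mul]
    exact mul_le_mul this this (Nat.cast_nonneg _) hm.le
  have hc := card_gridPoint_mem ha hb s
  have hc' := card_gridPoint_mem ha' hb' s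
  set I := Finset.univ.filter fun i => gridPoint s i ∈ Icc a b with hI
  set J := Finset.univ.filter fun i => gridPoint s i ∈ Icc a' b' with hJ
  have hI' : (b - a) / 2 * 2 ^ (s + 1) ≤ (I.card : ℝ) := by linarith
  have hJ' : (b' - a') / 2 * 2 ^ (s + 1) ≤ (J.card : ℝ) := by linarith
  have hsq : 0 ≤ δ * √(n : ℝ) := by positivity
  have hba : 0 < (b - a) / 2 := by linarith
  have hba' : 0 < (b' - a') / 2 := by linarith
  calc
    δ * ((b - a) / 2 * ((b' - a') / 2)) * √(n : ℝ) * gridCard s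
      ≤ δ * ((b - a) / 2 * ((b' - a') / 2)) * √(n : ℝ) * (2 ^ (s + 1) * 2 ^ (s + 1)) := by
        gcongr
    _ = ((b - a) / 2 * 2 ^ (s + 1)) * ((b' - a') / 2 * 2 ^ (s + 1)) * (δ * √(n : ℝ)) := by ring
    _ ≤ (I.card : ℝ) * J.card * (δ * √(n : ℝ)) := by gcongr
    _ = ∑ i ∈ I, ∑ j ∈ J, δ * √(n : ℝ) := by
        simp only [Finset.sum_const, nsmul_eq_mul]; ring
    _ ≤ ∑ i ∈ I, ∑ j ∈ J, |√(n : ℝ) * qBar z (gridPoint s i) (gridPoint s j)| := by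
        refine Finset.sum_le_sum fun i hi => Finset.sum_le_sum fun j hj => ?_
        rw [abs_mul, abs_of_nonneg (Real.sqrt_nonneg _), mul_comm]
        gcongr
        exact (h _ (Finset.mem_filter.1 hi).2 _ (Finset.mem_filter.1 hj).2).trans
          (abs_sub_le_abs_qBar z (gridPoint_mem s i) (gridPoint_mem s j))
    _ ≤ ∑ i ∈ I, ∑ j, |√(n : ℝ) * qBar z (gridPoint s i) (gridPoint s j)| := by
        refine Finset.sum_le_sum fun i _ => ?_
        exact Finset.sum_le_sum_of_subset_of_nonneg (Finset.subset_univ _)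
          fun _ _ _ => abs_nonneg _
    _ ≤ ∑ i, ∑ j, |√(n : ℝ) * qBar z (gridPoint s i) (gridPoint s j)| :=
        Finset.sum_le_sum_of_subset_of_nonneg (Finset.subset_univ _)
          fun _ _ _ => Finset.sum_nonneg fun _ _ => abs_nonneg _

/-! ### Consistency -/

/-- The assumption on the size of the grid enters through the union bound over its `d(n)²` points,
which costs `d(n)² / n`. -/
theorem tendsto_gridCard_div (s : ℕ → ℕ)
    (hdn : Tendsto (fun n : ℕ => (gridSize (s n) : ℝ) / √(n : ℝ)) atTop (𝓝 0)) {ε : ℝ}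
    (hε : 0 < ε) :
    Tendsto (fun n : ℕ => (gridCard (s n) : ℝ) / (((n : ℝ) - 1) * ε ^ 2)) atTop (𝓝 0) := by
  have hlim : Tendsto (fun n : ℕ => ((gridSize (s n) : ℝ) / √(n : ℝ)) ^ 2 * (2 / ε ^ 2)) atTop
      (𝓝 0) := by
    simpa using (hdn.pow 2).mul_const (2 / ε ^ 2)
  refine squeeze_zero' ?_ ?_ hlim
  · filter_upwards [eventually_ge_atTop 2] with n hn
    have : (2 : ℝ) ≤ n := by exact_mod_cast hn
    have : (0 : ℝ) ≤ (n : ℝ) - 1 := by linarith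
    positivity
  · filter_upwards [eventually_ge_atTop 2] with n hn
    have h2 : (2 : ℝ) ≤ n := by exact_mod_cast hn
    rw [div_pow, Real.sq_sqrt (Nat.cast_nonneg n), gridCard, Nat.cast_mul, ← sq, div_mul_div_comm,
      div_le_div_iff₀ (mul_pos (by linarith) (by positivity)) (by positivity)]
    have : 0 ≤ (gridSize (s n) : ℝ) ^ 2 * ε ^ 2 := by positivity
    nlinarith

theorem tendsto_rejectionRegion (s : ℕ → ℕ) (t : ℕ → ℝ) (ht : ∀ n, t n ∈ Ioo (0 : ℝ) 1)
    (hd : Tendsto (fun n => gridSize (s n)) atTop atTop)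
    (hdn : Tendsto (fun n : ℕ => (gridSize (s n) : ℝ) / √(n : ℝ)) atTop (𝓝 0))
    {α : ℝ} (hα : α ∈ Ioo (0 : ℝ) 1) (μ : Measure (ℝ × ℝ)) [IsProbabilityMeasure μ]
    (hc : ContinuousMargins μ) (hdep : ¬ Independence μ) :
    Tendsto (fun n => (sampleLaw μ n).real (rejectionRegion (s n) (t n) n α)) atTop (𝓝 1) := by
  obtain ⟨x₀, y₀, hu, hv, hne⟩ := exists_jointCdf_ne μ hdep
  obtain ⟨δ, hδ, a, b, a', b', ha, hab, hb, ha', hab', hb', N, hN⟩ := exists_square hu hv hne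
  set ρ := δ * ((b - a) / 2 * ((b' - a') / 2)) with hρ_def
  have hρ : 0 < ρ := by
    have h1 := sub_pos.2 hab
    have h2 := sub_pos.2 hab'
    positivity
  have hgrid : ∀ c : ℝ, 0 < c → ∀ᶠ n in atTop, 2 ≤ c * 2 ^ (s n + 1) := by
    intro c hc0
    have h := (tendsto_natCast_atTop_atTop (R := ℝ)).comp hd
    filter_upwards [h.eventually_ge_atTop (2 / c)] with n hn
    have hn' : 2 / c ≤ (gridSize (s n) : ℝ) := hn
    rw [gridSize_cast, div_le_iff₀ hc0] at hn'
    linarith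
  have hcrit := (tendsto_gridCard_div s hdn (half_pos hρ)).eventually (ge_mem_nhds hα.1)
  have hlow : ∀ᶠ n : ℕ in atTop, 1 - 3 / ((n : ℝ) * (δ / 6) ^ 2) ≤
      (sampleLaw μ n).real (rejectionRegion (s n) (t n) n α) := by
    obtain ⟨M, hM⟩ := exists_nat_ge (4 / δ)
    filter_upwards [hcrit, hgrid _ (sub_pos.2 hab), hgrid _ (sub_pos.2 hab'),
      eventually_ge_atTop N, eventually_ge_atTop M, eventually_ge_atTop 2]
      with n hn1 hn2 hn3 hnN hnM hn
    have hn0 : (0 : ℝ) < n := by positivity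
    have hcv : criticalValue (s n) (t n) n α ≤ ρ / 2 * √(n : ℝ) :=
      criticalValue_le (ht n) hα.2 hn (half_pos hρ) hn1 _ (continuousMargins_prod μ hc)
        (independence_prod μ)
    have herr : 3 * (δ / 6) + 2 / n ≤ δ := by
      have h4 : 4 / δ ≤ n := hM.trans (by exact_mod_cast hnM)
      rw [div_le_iff₀ hδ] at h4
      have : 2 / (n : ℝ) ≤ δ / 2 := by
        rw [div_le_div_iff₀ hn0 two_pos]
        linarith
      linarith
    have hbad := measureReal_lt_abs_empCopula_sub_le μ hc x₀ y₀ (by omega : 0 < n)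
      (by positivity : 0 < δ / 6)
    set E := {z : Fin n → ℝ × ℝ | 3 * (δ / 6) + 2 / n <
      |empCopula z (cdf μ.fst x₀) (cdf μ.snd y₀) - jointCdf μ x₀ y₀|}
    have hcover : univ ⊆ rejectionRegion (s n) (t n) n α ∪ E := by
      intro z _
      by_cases hz : z ∈ E
      · exact Or.inr hz
      · refine Or.inl ?_
        have hT := le_testStat_of_square (ht n) ha hab hb ha' hab' hb' hδ hn2 hn3
          (hN n hnN z ((not_lt.1 hz).trans herr))
        have hsq : 0 < ρ * √(n : ℝ) := mul_pos hρ (Real.sqrt_pos.2 hn0)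
        rw [← hρ_def] at hT
        change criticalValue (s n) (t n) n α < testStat (s n) (t n) z
        linarith
    have h1 := (measureReal_mono (μ := sampleLaw μ n) hcover).trans (measureReal_union_le _ _)
    rw [probReal_univ] at h1
    linarith
  have hlim : Tendsto (fun n : ℕ => 1 - 3 / ((n : ℝ) * (δ / 6) ^ 2)) atTop (𝓝 1) := by
    have h := (tendsto_natCast_atTop_atTop (R := ℝ)).atTop_mul_const
      (by positivity : 0 < (δ / 6) ^ 2)
    simpa using (h.const_div_atTop 3).const_sub 1
  exact tendsto_of_tendsto_of_tendsto_of_le_of_le' hlim tendsto_const_nhds hlow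
    (Eventually.of_forall fun n => measureReal_le_one)

end RankTest

theorem theorem1 (s : ℕ → ℕ) (t : ℕ → ℝ)
    (ht : ∀ n, t n ∈ Set.Ioo (0 : ℝ) 1)
    (hd : Tendsto (fun n => RankTest.gridSize (s n)) atTop atTop)
    (hdn : Tendsto (fun n : ℕ => (RankTest.gridSize (s n) : ℝ) / √(n : ℝ)) atTop (𝓝 0))
    (α : ℝ) (hα : α ∈ Set.Ioo (0 : ℝ) 1) :
    (∀ (n : ℕ) (ν : Measure (ℝ × ℝ)) [IsProbabilityMeasure ν],
      RankTest.ContinuousMargins ν → RankTest.Independence ν →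
        (RankTest.sampleLaw ν n).real (RankTest.rejectionRegion (s n) (t n) n α) ≤ α) ∧
    (∀ (μ : Measure (ℝ × ℝ)) [IsProbabilityMeasure μ],
      RankTest.ContinuousMargins μ → RankTest.ContinuousPartials (RankTest.copula μ) →
      ¬ RankTest.Independence μ →
        Tendsto (fun n => (RankTest.sampleLaw μ n).real
          (RankTest.rejectionRegion (s n) (t n) n α)) atTop (𝓝 1)) :=
  ⟨fun n ν _ hc hi => RankTest.measureReal_rejectionRegion_le (s n) n (ht n) hα ν hc hi,
    fun μ _ hc _ hdep => RankTest.tendsto_rejectionRegion s t ht hd hdn hα μ hc hdep⟩
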